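/- Let $\beta,\gamma>0$ with $\beta+2\gamma<1$. For $N\ge 1$ and $i,j\in[N]=\{1,\dots,N\}$ put $p_{ij}=\frac{\beta N^{2\gamma-1}}{i^\gamma j^\gamma}\wedge 1$. Let $(G_N)_{N\ge1}$ be a sequence of simple random graphs, $G_N$ having vertex set $[N]$, in the class $\mathcal G_{\beta,\gamma}$: for every $N$ there is a symmetric array $(q_{ij})_{i,j\in[N]}$ of numbers in $(0,\tfrac12)$ (depending on $N$) such that each edge $\{i,j\}$, $i\ne j$, is present in $G_N$ independently of all others with probability $q_{ij}$, and $$\lim_{N\to\infty}\sum_{i\ne j}\frac{(p_{ij}-q_{ij})^2}{p_{ij}}=0 .$$ Let $K_\gamma=N^{\frac{1-2\gamma}{2-2\gamma}}\log N$ and let $\operatorname{d}(v)$ denote the degree of $v$ in $G_N$. Then, with high probability, $G_N$ contains a path $(v_1,v_2,v_3,v_4)$ (four distinct vertices) such that (a) $\operatorname{d}(v_2)=\operatorname{d}(v_3)=2$; (b) $v_1\le K_\gamma$ and $v_4\le K_\gamma$, and the connected component of $G_N$ containing the path is a tree; (c) $\operatorname{d}(v_1),\operatorname{d}(v_4)=\Theta_{\mathbb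 P}^{\log N}\big(N^{\frac{\gamma}{2-2\gamma}}\big)$. Precisely: there is a constant $C>0$ such that the probability that $G_N$ contains a path with (a), (b) and $$N^{\frac{\gamma}{2-2\gamma}}(\log N)^{-C}\le \operatorname{d}(v_1),\operatorname{d}(v_4)\le N^{\frac{\gamma}{2-2\gamma}}(\log N)^{C}$$ tends to $1$ as $N\to\infty$. -/

import Mathlib

open MeasureTheory ProbabilityTheory Filter Topology

noncomputable section

/-- The Chung-Lu connection probability `p_{ij} = min (β N^{2γ-1} / (i^γ j^γ)) 1`.
The vertex set `[N] = {1, …, N}` is modelled by `Fin N`; the element `i : Fin N` is the vertex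
with label `i + 1`. -/
def chungLuProb (β γ : ℝ) (N : ℕ) (i j : Fin N) : ℝ :=
  min (β * (N : ℝ) ^ (2 * γ - 1) /
    ((((i : ℕ) : ℝ) + 1) ^ γ * (((j : ℕ) : ℝ) + 1) ^ γ)) 1

/-- `G` is a random simple graph on `[N]` in which the edges `{i, j}`, `i ≠ j`, are present
independently of each other with probabilities `q i j`. -/
structure IsInhomogeneousRandomGraph {N : ℕ} {Ω : Type*} [MeasurableSpace Ω]
    (μ : Measure Ω) (q : Fin N → Fin N → ℝ) (G : Ω → SimpleGraph (Fin N)) : Prop where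
  measurableSet_adj : ∀ i j : Fin N, MeasurableSet {ω | (G ω).Adj i j}
  prob_adj : ∀ i j : Fin N, i ≠ j → μ.real {ω | (G ω).Adj i j} = q i j
  indep : iIndepSet
    (fun e : {e : Fin N × Fin N // e.1 < e.2} => {ω | (G ω).Adj e.1.1 e.1.2}) μ

/-- The sequence `(G_N)` of random graphs belongs to the class `𝒢_{β,γ}`: `G_N` is an
inhomogeneous random graph on `[N]` with edge probabilities `q_{ij} ∈ (0, 1/2)` such that
`∑_{i ≠ j} (p_{ij} - q_{ij})² / p_{ij} → 0`. -/
def InClassG (β γ : ℝ) {Ω : ℕ → Type*} [∀ N, MeasurableSpace (Ω N)]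
    (μ : ∀ N, Measure (Ω N)) (G : ∀ N, Ω N → SimpleGraph (Fin N)) : Prop :=
  ∃ q : ∀ N, Fin N → Fin N → ℝ,
    (∀ N i j, q N i j = q N j i) ∧
    (∀ N i j, 0 < q N i j ∧ q N i j < 1 / 2) ∧
    (∀ N, IsInhomogeneousRandomGraph (μ N) (q N) (G N)) ∧
    Tendsto
      (fun N => ∑ i : Fin N, ∑ j : Fin N,
        if i ≠ j then (chungLuProb β γ N i j - q N i j) ^ 2 / chungLuProb β γ N i j else 0)
      atTop (𝓝 0)

/-- The threshold `K_γ = N^{(1-2γ)/(2-2γ)} log N`. -/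
def bigThreshold (γ : ℝ) (N : ℕ) : ℝ :=
  (N : ℝ) ^ ((1 - 2 * γ) / (2 - 2 * γ)) * Real.log N

/-- The degree of a vertex, i.e. the number of its neighbours. -/
def vertexDegree {N : ℕ} (G : SimpleGraph (Fin N)) (v : Fin N) : ℕ :=
  (G.neighborSet v).ncard

/-- `x` and `y` agree up to the factor `(log N)^C`:
`x ≤ y (log N)^C` and `y ≤ x (log N)^C`. -/
def AgreeUpToLog (C : ℝ) (N : ℕ) (x y : ℝ) : Prop :=
  x ≤ y * Real.log N ^ C ∧ y ≤ x * Real.log N ^ C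

/-- `(v₁, v₂, v₃, v₄)` is a path of `G` (with four distinct vertices) such that
`d(v₂) = d(v₃) = 2`, the labels of `v₁` and `v₄` are at most `K_γ`, the component of `G`
containing the path is a tree, and `d(v₁)`, `d(v₄)` agree with `N^{γ/(2-2γ)}` up to the
factor `(log N)^C`. -/
structure IsLongDoubleStar (γ C : ℝ) {N : ℕ} (G : SimpleGraph (Fin N))
    (v₁ v₂ v₃ v₄ : Fin N) : Prop where
  nodup : [v₁, v₂, v₃, v₄].Nodup
  adj₁₂ : G.Adj v₁ v₂
  adj₂₃ : G.Adj v₂ v₃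
  adj₃₄ : G.Adj v₃ v₄
  degree₂ : vertexDegree G v₂ = 2
  degree₃ : vertexDegree G v₃ = 2
  label₁ : ((v₁ : ℕ) : ℝ) + 1 ≤ bigThreshold γ N
  label₄ : ((v₄ : ℕ) : ℝ) + 1 ≤ bigThreshold γ N
  isTree : (G.induce (G.connectedComponentMk v₁).supp).IsTree
  degree₁ : AgreeUpToLog C N (vertexDegree G v₁) ((N : ℝ) ^ (γ / (2 - 2 * γ)))
  degree₄ : AgreeUpToLog C N (vertexDegree G v₄) ((N : ℝ) ^ (γ / (2 - 2 * γ)))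

end

/-!
The proof finds the path in the Chung-Lu graph with edge probabilities `p`, by a second moment
argument, and transfers the result to `G_N`.

*Transfer.* The law of `G_N` has chi-square divergence at most `exp (2 ∑ (p - q)² / p) - 1` from
that of the graph with edge probabilities `p`, because the divergence of a product measure is a
product (`sq_bernProb_sub_le`). Hence both assign asymptotically the same probability to every
event. Random graphs are treated as random finite sets of unordered pairs, with an explicit
weight for each set (`bernWeight`). For large `N` the minimum in the definition of `p` is not
attained by `1`, so that `p` has rank one: `p_{ij} = c x_i x_j` with `c = β N ^ (2γ - 1) → 0`,
`x_i = i ^ (-γ)`, and `c ∑ x² ≤ β / (1 - 2γ) < 1`.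

*Second moment.* Candidates for `(v₁, v₂, v₃, v₄)` are quadruples with `v₁`, `v₄` of order `K_γ` and
`v₂`, `v₃` of order `N`. A candidate occurs if its three edges are present and no other edge touches
`v₂` or `v₃`; this prescribes the random set on the pairs touching `v₂` or `v₃`. The
expected number of occurrences is of order `(log N) ^ (2 - 2γ)`. Two candidates that share a centre
exclude each other, and all other pairs are almost independent, since the pairs touching a centre
of both are at most four and are absent in both (`bernProb_path_inter_le`). So the number of
occurrences concentrates.

*Tree and degrees.* Whether an occurring candidate has the remaining properties depends only on the
pairs that do not touch `v₂` and `v₃`, hence is independent of its occurrence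
(`bernProb_forall_bad_le`). The component is a tree unless the remaining edges contain a trail from
`v₁` to `v₄`, or a trail from `v₁` or `v₄` that leads to a cycle
(`isTree_of_forall_notMem_lasso`). As the graph is subcritical, the expected numbers of such trails
are sums of geometric series, of order `c` (`bernProb_trailBetween_le`, `bernProb_lasso_le`).
The degrees of `v₁` and `v₄` are controlled by Chebyshev's inequality, and their means are of order
`(N / K_γ) ^ γ = N ^ (γ / (2 - 2γ)) (log N) ^ (-γ)`, so the exponent `C = 1` suffices.
-/

noncomputable section

/-! ### Random subsets of a finite set -/

section RandomSubset

variable {ι : Type*} [Fintype ι] [DecidableEq ι]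

/-- The probability that a random subset of `ι`, which contains each `i` independently with
probability `p i`, is equal to `S`. -/
def bernWeight (p : ι → ℝ) (S : Finset ι) : ℝ := ∏ i, if i ∈ S then p i else 1 - p i

/-- The expectation of `f` of a random subset which contains each `i` independently with
probability `p i`. -/
def bernExp (p : ι → ℝ) (f : Finset ι → ℝ) : ℝ := ∑ S, bernWeight p S * f S

/-- The probability that a random subset which contains each `i` independently with
probability `p i` belongs to `A`. -/
def bernProb (p : ι → ℝ) (A : Set (Finset ι)) : ℝ := bernExp p (A.indicator 1)

/-- The probability that a random subset which contains each `i` independently with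
probability `p i` agrees with `D` on `F`, if `D ⊆ F`; see `bernProb_cylinder`. -/
def cylinderProb (p : ι → ℝ) (F D : Finset ι) : ℝ := ∏ i ∈ F, if i ∈ D then p i else 1 - p i

variable {p : ι → ℝ}

lemma bernWeight_nonneg (hp : ∀ i, 0 ≤ p i ∧ p i ≤ 1) (S : Finset ι) : 0 ≤ bernWeight p S :=
  Finset.prod_nonneg fun i _ => by
    split_ifs
    · exact (hp i).1
    · linarith [(hp i).2]

lemma prod_ite_mem_univ (S : Finset ι) (a b : ι → ℝ) :
    (∏ i, if i ∈ S then a i else b i) = (∏ i ∈ S, a i) * ∏ i ∈ Finset.univ \ S, b i := by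
  rw [Finset.prod_ite, Finset.filter_univ_mem]
  congr 2
  ext i
  simp

lemma bernExp_prod (p a b : ι → ℝ) :
    bernExp p (fun S => ∏ i, if i ∈ S then a i else b i) =
      ∏ i, (p i * a i + (1 - p i) * b i) := by
  rw [Finset.prod_add, Finset.powerset_univ]
  refine Finset.sum_congr rfl fun S _ => ?_
  rw [← prod_ite_mem_univ, bernWeight, ← Finset.prod_mul_distrib]
  refine Finset.prod_congr rfl fun i _ => ?_
  split_ifs <;> rfl

lemma sum_bernWeight (p : ι → ℝ) : ∑ S, bernWeight p S = 1 := by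
  have h := bernExp_prod p (fun _ => 1) (fun _ => 1)
  simpa [bernExp] using h

lemma bernExp_add (p : ι → ℝ) (f g : Finset ι → ℝ) :
    bernExp p (fun S => f S + g S) = bernExp p f + bernExp p g := by
  simp [bernExp, mul_add, Finset.sum_add_distrib]

lemma bernExp_const (p : ι → ℝ) (c : ℝ) : bernExp p (fun _ => c) = c := by
  simp [bernExp, ← Finset.sum_mul, sum_bernWeight]

lemma bernExp_const_mul (p : ι → ℝ) (c : ℝ) (f : Finset ι → ℝ) :
    bernExp p (fun S => c * f S) = c * bernExp p f := by
  simp only [bernExp, Finset.mul_sum]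
  exact Finset.sum_congr rfl fun S _ => by ring

lemma bernExp_sum {κ : Type*} (p : ι → ℝ) (s : Finset κ) (f : κ → Finset ι → ℝ) :
    bernExp p (fun S => ∑ k ∈ s, f k S) = ∑ k ∈ s, bernExp p (f k) := by
  simp only [bernExp, Finset.mul_sum]
  exact Finset.sum_comm

lemma bernExp_mono (hp : ∀ i, 0 ≤ p i ∧ p i ≤ 1) {f g : Finset ι → ℝ} (h : ∀ S, f S ≤ g S) :
    bernExp p f ≤ bernExp p g :=
  Finset.sum_le_sum fun S _ => mul_le_mul_of_nonneg_left (h S) (bernWeight_nonneg hp S)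

lemma bernExp_nonneg (hp : ∀ i, 0 ≤ p i ∧ p i ≤ 1) {f : Finset ι → ℝ} (h : ∀ S, 0 ≤ f S) :
    0 ≤ bernExp p f :=
  Finset.sum_nonneg fun S _ => mul_nonneg (bernWeight_nonneg hp S) (h S)

lemma bernProb_nonneg (hp : ∀ i, 0 ≤ p i ∧ p i ≤ 1) (A : Set (Finset ι)) : 0 ≤ bernProb p A :=
  bernExp_nonneg hp fun S => Set.indicator_nonneg (fun _ _ => zero_le_one) S

lemma bernProb_mono (hp : ∀ i, 0 ≤ p i ∧ p i ≤ 1) {A B : Set (Finset ι)} (h : A ⊆ B) :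
    bernProb p A ≤ bernProb p B :=
  bernExp_mono hp fun S => Set.indicator_le_indicator_of_subset h (fun _ => zero_le_one) S

lemma bernProb_le_one (hp : ∀ i, 0 ≤ p i ∧ p i ≤ 1) (A : Set (Finset ι)) : bernProb p A ≤ 1 := by
  rw [← bernExp_const p 1]
  exact bernExp_mono hp fun S => Set.indicator_le_self' (fun _ _ => zero_le_one) S

lemma bernProb_compl (p : ι → ℝ) (A : Set (Finset ι)) :
    bernProb p Aᶜ = 1 - bernProb p A := by
  rw [eq_sub_iff_add_eq, bernProb, bernProb, ← bernExp_add, ← bernExp_const p 1]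
  congr 1
  ext S
  exact congrFun (Set.indicator_compl_add_self A (1 : Finset ι → ℝ)) S

lemma bernProb_iUnion_le {κ : Type*} (hp : ∀ i, 0 ≤ p i ∧ p i ≤ 1) (s : Finset κ)
    (A : Set (Finset ι)) (B : κ → Set (Finset ι)) (h : ∀ S ∈ A, ∃ k ∈ s, S ∈ B k) :
    bernProb p A ≤ ∑ k ∈ s, bernProb p (B k) := by
  unfold bernProb
  rw [← bernExp_sum]
  refine bernExp_mono hp fun S => ?_
  by_cases hS : S ∈ A
  · obtain ⟨k, hk, hSk⟩ := h S hS
    rw [Set.indicator_of_mem hS]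
    refine le_trans ?_ (Finset.single_le_sum
      (fun j _ => Set.indicator_nonneg (fun _ _ => zero_le_one) S) hk)
    simp [hSk]
  · rw [Set.indicator_of_notMem hS]
    exact Finset.sum_nonneg fun j _ => Set.indicator_nonneg (fun _ _ => zero_le_one) S

lemma bernProb_union_le (hp : ∀ i, 0 ≤ p i ∧ p i ≤ 1) (A B : Set (Finset ι)) :
    bernProb p (A ∪ B) ≤ bernProb p A + bernProb p B := by
  have := bernProb_iUnion_le hp (Finset.univ : Finset Bool) (A ∪ B) (fun b => cond b A B)
    (fun S hS => by
      rcases hS with h | h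
      · exact ⟨true, by simp, h⟩
      · exact ⟨false, by simp, h⟩)
  simpa using this

/-- The parts of the random subset inside and outside of `F` are independent. The proof exchanges
the parts outside of `F` of two independent copies. -/
lemma bernExp_mul_of_disjoint (p : ι → ℝ) (F : Finset ι) (f g : Finset ι → ℝ) :
    bernExp p (fun S => f (S ∩ F) * g (S \ F)) =
      bernExp p (fun S => f (S ∩ F)) * bernExp p (fun S => g (S \ F)) := by
  have h1 : bernExp p (fun S => f (S ∩ F) * g (S \ F)) =
      ∑ x : Finset ι × Finset ι,
        bernWeight p x.1 * bernWeight p x.2 * (f (x.1 ∩ F) * g (x.1 \ F)) := by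
    rw [Fintype.sum_prod_type]
    refine Finset.sum_congr rfl fun S _ => ?_
    simp only
    rw [← Finset.sum_mul, ← Finset.mul_sum, sum_bernWeight, mul_one]
  have h2 : bernExp p (fun S => f (S ∩ F)) * bernExp p (fun S => g (S \ F)) =
      ∑ x : Finset ι × Finset ι,
        bernWeight p x.1 * bernWeight p x.2 * (f (x.1 ∩ F) * g (x.2 \ F)) := by
    rw [Fintype.sum_prod_type, bernExp, bernExp, Finset.sum_mul_sum]
    exact Finset.sum_congr rfl fun S _ => Finset.sum_congr rfl fun T _ => by ring
  let sw : Finset ι × Finset ι → Finset ι × Finset ι :=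
    fun x => ((x.1 ∩ F) ∪ (x.2 \ F), (x.2 ∩ F) ∪ (x.1 \ F))
  have hsw : Function.Involutive sw := by
    rintro ⟨S, T⟩
    simp only [sw, Prod.mk.injEq]
    constructor <;> ext i <;> simp only [Finset.mem_union, Finset.mem_inter, Finset.mem_sdiff] <;>
      tauto
  rw [h1, h2]
  refine Fintype.sum_equiv hsw.toPerm _ _ fun x => ?_
  obtain ⟨S, T⟩ := x
  simp only [Function.Involutive.coe_toPerm, sw]
  congr 1
  · simp only [bernWeight, ← Finset.prod_mul_distrib]
    refine Finset.prod_congr rfl fun i _ => ?_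
    by_cases hF : i ∈ F <;> by_cases hS : i ∈ S <;> by_cases hT : i ∈ T <;>
      simp [hF, hS, hT, mul_comm]
  · congr 2 <;> ext i <;> simp only [Finset.mem_union, Finset.mem_inter, Finset.mem_sdiff] <;>
      tauto

lemma bernProb_inter_of_disjoint (p : ι → ℝ) (F : Finset ι) (A B : Set (Finset ι)) :
    bernProb p ({S | S ∩ F ∈ A} ∩ {S | S \ F ∈ B}) =
      bernProb p {S | S ∩ F ∈ A} * bernProb p {S | S \ F ∈ B} := by
  have h := bernExp_mul_of_disjoint p F (A.indicator 1) (B.indicator 1)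
  unfold bernProb
  rw [show ({S | S ∩ F ∈ A} : Set (Finset ι)).indicator 1 =
      fun S => A.indicator (1 : Finset ι → ℝ) (S ∩ F) from rfl,
    show ({S | S \ F ∈ B} : Set (Finset ι)).indicator 1 =
      fun S => B.indicator (1 : Finset ι → ℝ) (S \ F) from rfl, ← h]
  congr 1
  ext S
  by_cases h1 : S ∩ F ∈ A <;> by_cases h2 : S \ F ∈ B <;> simp [Set.indicator, h1, h2]

lemma bernProb_cylinder (p : ι → ℝ) {F D : Finset ι} (hD : D ⊆ F) :
    bernProb p {S | S ∩ F = D} = cylinderProb p F D := by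
  have h := bernExp_prod p (fun i => if i ∈ F → i ∈ D then 1 else 0)
    (fun i => if i ∈ D then 0 else 1)
  have h2 : (∏ i, (p i * (if i ∈ F → i ∈ D then 1 else 0) +
      (1 - p i) * (if i ∈ D then 0 else 1))) = cylinderProb p F D := by
    rw [cylinderProb, ← Finset.prod_subset (Finset.subset_univ F)]
    · refine Finset.prod_congr rfl fun i hi => ?_
      by_cases hiD : i ∈ D <;> simp [hi, hiD]
    · intro i _ hi
      have : i ∉ D := fun h => hi (hD h)
      simp [hi, this]
  rw [← h2, ← h, bernProb]
  congr 1
  ext S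
  by_cases hS : S ∩ F = D
  · rw [Set.indicator_of_mem (by exact hS), Pi.one_apply]
    symm
    refine Finset.prod_eq_one fun i _ => ?_
    subst hS
    by_cases hi : i ∈ S <;> simp [hi]
  · rw [Set.indicator_of_notMem (by exact hS)]
    symm
    rw [Finset.prod_eq_zero_iff]
    by_contra hcon
    push Not at hcon
    refine hS ?_
    ext i
    have h3 := hcon i (Finset.mem_univ i)
    have h4 : i ∈ D → i ∈ F := fun h => hD h
    rw [Finset.mem_inter]
    by_cases hi : i ∈ S
    · simp only [hi, if_true, ne_eq, ite_eq_right_iff, not_forall] at h3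
      obtain ⟨h3, -⟩ := h3
      exact ⟨fun h => h3 h.2, fun h => ⟨hi, h4 h⟩⟩
    · simp only [hi, if_false, ne_eq, ite_eq_left_iff, not_forall] at h3
      obtain ⟨h3, -⟩ := h3
      exact ⟨fun h => absurd h.1 hi, fun h => absurd h h3⟩

lemma bernProb_mem (p : ι → ℝ) (i : ι) : bernProb p {S | i ∈ S} = p i := by
  have h := bernProb_cylinder p (F := {i}) (D := {i}) le_rfl
  simpa [cylinderProb] using h

/-- An element and the rest of the random subset are independent; an increasing event that is
required of the rest only is at most as likely as the event itself. -/
lemma bernProb_mem_erase_le (hp : ∀ i, 0 ≤ p i ∧ p i ≤ 1) (i : ι) {A : Set (Finset ι)}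
    (hA : IsUpperSet A) : bernProb p {S | i ∈ S ∧ S.erase i ∈ A} ≤ p i * bernProb p A := by
  have h := bernProb_inter_of_disjoint p {i} {T | i ∈ T} A
  have h1 : ({S | i ∈ S ∧ S.erase i ∈ A} : Set (Finset ι)) =
      {S | S ∩ {i} ∈ {T : Finset ι | i ∈ T}} ∩ {S | S \ {i} ∈ A} := by
    ext S
    simp [Finset.sdiff_singleton_eq_erase]
  have h2 : ({S | S ∩ {i} ∈ {T : Finset ι | i ∈ T}} : Set (Finset ι)) = {S | i ∈ S} := by
    ext S
    simp
  rw [h1, h, h2, bernProb_mem]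
  refine mul_le_mul_of_nonneg_left (bernProb_mono hp fun S hS => ?_) (hp i).1
  exact hA Finset.sdiff_subset hS

/-! ### Chebyshev's inequality for the number of elements in a given set -/

lemma bernExp_sq_centered (p : ι → ℝ) (T : Finset ι) :
    bernExp p (fun S => (((S ∩ T).card : ℝ) - ∑ i ∈ T, p i) ^ 2) = ∑ i ∈ T, p i * (1 - p i) ∧
    bernExp p (fun S => ((S ∩ T).card : ℝ) - ∑ i ∈ T, p i) = 0 := by
  induction T using Finset.induction_on with
  | empty => simp [bernExp_const]
  | insert i T hi ih =>
    obtain ⟨ih2, ih1⟩ := ih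
    let f : Finset ι → ℝ := fun S => (if i ∈ S then 1 else 0) - p i
    let g : Finset ι → ℝ := fun S => ((S ∩ T).card : ℝ) - ∑ j ∈ T, p j
    have hf : ∀ S, f (S ∩ {i}) = f S := fun S => by simp [f]
    have hg : ∀ S, g (S \ {i}) = g S := fun S => by
      have : (S \ {i}) ∩ T = S ∩ T := by
        ext j
        simp only [Finset.mem_inter, Finset.mem_sdiff, Finset.mem_singleton]
        constructor
        · tauto
        · rintro ⟨h1, h2⟩
          exact ⟨⟨h1, fun h => hi (h ▸ h2)⟩, h2⟩
      simp [g, this]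
    have hsum : ∀ S : Finset ι,
        ((S ∩ insert i T).card : ℝ) - ∑ j ∈ insert i T, p j = f S + g S := by
      intro S
      rw [Finset.sum_insert hi]
      by_cases hS : i ∈ S
      · rw [Finset.inter_insert_of_mem hS, Finset.card_insert_of_notMem (by simp [hi])]
        simp only [f, g, hS, if_true]
        push_cast
        ring
      · rw [Finset.inter_insert_of_notMem hS]
        simp only [f, g, hS, if_false]
        ring
    have hE : bernExp p (fun S => if i ∈ S then (1 : ℝ) else 0) = p i := by
      rw [← bernProb_mem p i, bernProb]
      congr 1
      ext S
      by_cases h : i ∈ S <;> simp [Set.indicator, h]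
    have hE1 : bernExp p f = 0 := by
      have := bernExp_add p (fun S => if i ∈ S then (1 : ℝ) else 0) (fun _ => - p i)
      rw [hE, bernExp_const] at this
      simp only [f, sub_eq_add_neg]
      rw [this]
      ring
    have hE2 : bernExp p (fun S => f S ^ 2) = p i * (1 - p i) := by
      have h : (fun S : Finset ι => f S ^ 2) =
          fun S => (1 - 2 * p i) * (if i ∈ S then (1 : ℝ) else 0) + p i ^ 2 := by
        ext S
        simp only [f]
        split_ifs <;> ring
      rw [h, bernExp_add, bernExp_const_mul, bernExp_const, hE]
      ring
    have hfg : bernExp p (fun S => f S * g S) = 0 := by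
      have h := bernExp_mul_of_disjoint p {i} f g
      simp only [hf, hg] at h
      rw [h, hE1, zero_mul]
    simp only [hsum]
    constructor
    · have h : (fun S : Finset ι => (f S + g S) ^ 2) =
          fun S => f S ^ 2 + (2 * (f S * g S) + g S ^ 2) := by
        ext S
        ring
      rw [h, bernExp_add, bernExp_add, bernExp_const_mul, hE2, hfg, ih2, Finset.sum_insert hi]
      ring
    · rw [bernExp_add, hE1, ih1, add_zero]

lemma bernProb_card_deviation_le (hp : ∀ i, 0 ≤ p i ∧ p i ≤ 1) (T : Finset ι)
    (hT : 0 < ∑ i ∈ T, p i) :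
    bernProb p {S | (∑ i ∈ T, p i) / 2 ≤ |((S ∩ T).card : ℝ) - ∑ i ∈ T, p i|} ≤
      4 / ∑ i ∈ T, p i := by
  set m := ∑ i ∈ T, p i with hm
  have h1 := (bernExp_sq_centered p T).1
  have h2 : ∑ i ∈ T, p i * (1 - p i) ≤ m := Finset.sum_le_sum fun i _ => by
    nlinarith [(hp i).1, (hp i).2]
  calc _ ≤ bernExp p (fun S => 4 / m ^ 2 * (((S ∩ T).card : ℝ) - m) ^ 2) := by
        refine bernExp_mono hp fun S => ?_
        by_cases hS : m / 2 ≤ |((S ∩ T).card : ℝ) - m|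
        · rw [Set.indicator_of_mem (by exact hS), Pi.one_apply, ← sq_abs (_ - m)]
          have : (m / 2) ^ 2 ≤ |((S ∩ T).card : ℝ) - m| ^ 2 := by gcongr
          rw [div_mul_eq_mul_div, le_div_iff₀ (by positivity)]
          nlinarith
        · rw [Set.indicator_of_notMem (by exact hS)]
          positivity
    _ ≤ 4 / m ^ 2 * m := by
        rw [bernExp_const_mul, h1]
        gcongr
    _ = 4 / m := by field_simp

/-! ### Comparison of two random subsets -/

/-- The total variation distance of two random subsets is bounded by their chi-square
divergence, which is a product because the elements are independent. -/
lemma sq_bernProb_sub_le {q : ι → ℝ} (hp : ∀ i, 0 ≤ p i ∧ p i ≤ 1 / 2)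
    (hpq : ∀ i, p i = 0 → q i = 0) (A : Set (Finset ι)) :
    (bernProb q A - bernProb p A) ^ 2 ≤ Real.exp (2 * ∑ i, (p i - q i) ^ 2 / p i) - 1 := by
  have hp' : ∀ i, 0 ≤ p i ∧ p i ≤ 1 := fun i => ⟨(hp i).1, by linarith [(hp i).2]⟩
  let R : Finset ι → ℝ := fun S => ∏ i, if i ∈ S then q i / p i else (1 - q i) / (1 - p i)
  -- `R` is the density of the first law with respect to the second one; the junk value of `q i / p i`
  -- at `p i = 0` is harmless since then `q i = 0`.
  have hR : ∀ S, bernWeight q S = bernWeight p S * R S := by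
    intro S
    simp only [bernWeight, R, ← Finset.prod_mul_distrib]
    refine Finset.prod_congr rfl fun i _ => ?_
    split_ifs
    · by_cases h0 : p i = 0
      · simp [h0, hpq i h0]
      · field_simp
    · have : 1 - p i ≠ 0 := by linarith [(hp i).2]
      field_simp
  have hR1 : bernExp p R = 1 := by
    rw [← sum_bernWeight q]
    exact Finset.sum_congr rfl fun S _ => (hR S).symm
  have hR2 : bernExp p (fun S => R S ^ 2) ≤ Real.exp (2 * ∑ i, (p i - q i) ^ 2 / p i) := by
    have h : (fun S => R S ^ 2) = fun S : Finset ι =>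
        ∏ i, if i ∈ S then (q i / p i) ^ 2 else ((1 - q i) / (1 - p i)) ^ 2 := by
      ext S
      simp only [R, ← Finset.prod_pow]
      exact Finset.prod_congr rfl fun i _ => by split_ifs <;> rfl
    rw [h, bernExp_prod, Finset.mul_sum, Real.exp_sum]
    refine Finset.prod_le_prod (fun i _ => ?_) fun i _ => ?_
    · have := hp' i
      have : 0 ≤ 1 - p i := by linarith
      have := (hp i).1
      positivity
    · by_cases h0 : p i = 0
      · simp [h0, hpq i h0]
      · have hpos : 0 < p i := lt_of_le_of_ne (hp i).1 (Ne.symm h0)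
        have h1 : 0 < 1 - p i := by linarith [(hp i).2]
        have h2 : p i * (q i / p i) ^ 2 + (1 - p i) * ((1 - q i) / (1 - p i)) ^ 2 =
            (p i - q i) ^ 2 / p i * (1 / (1 - p i)) + 1 := by
          field_simp
          ring
        have h3 : 1 / (1 - p i) ≤ 2 := by
          rw [div_le_iff₀ h1]
          linarith [(hp i).2]
        rw [h2]
        refine le_trans ?_ (Real.add_one_le_exp _)
        have h4 : (p i - q i) ^ 2 / p i * (1 / (1 - p i)) ≤ (p i - q i) ^ 2 / p i * 2 := by
          gcongr
        linarith
  have hdiff : bernProb q A - bernProb p A =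
      ∑ S, bernWeight p S * (R S - 1) * A.indicator 1 S := by
    simp only [bernProb, bernExp, hR, ← Finset.sum_sub_distrib]
    exact Finset.sum_congr rfl fun S _ => by ring
  have hCS := Finset.sum_sq_le_sum_mul_sum_of_sq_le_mul Finset.univ
    (r := fun S => bernWeight p S * (R S - 1) * A.indicator 1 S)
    (f := fun S => bernWeight p S * (R S - 1) ^ 2)
    (g := fun S => bernWeight p S * A.indicator 1 S)
    (fun S _ => mul_nonneg (bernWeight_nonneg hp' S) (sq_nonneg _))
    (fun S _ => mul_nonneg (bernWeight_nonneg hp' S)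
      (Set.indicator_nonneg (fun _ _ => zero_le_one) S))
    (fun S _ => le_of_eq (by by_cases h : S ∈ A <;> simp [h]; ring))
  rw [hdiff]
  refine hCS.trans ?_
  have h5 : ∑ S, bernWeight p S * (R S - 1) ^ 2 = bernExp p (fun S => R S ^ 2) - 1 := by
    have h6 : (fun S => R S ^ 2) = fun S => (R S - 1) ^ 2 + (2 * R S + (-1)) := by
      ext S
      ring
    rw [h6, bernExp_add, bernExp_add, bernExp_const_mul, bernExp_const, hR1, bernExp]
    ring
  have h7 : ∑ S, bernWeight p S * A.indicator 1 S ≤ 1 := bernProb_le_one hp' A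
  have h8 : 0 ≤ ∑ S, bernWeight p S * (R S - 1) ^ 2 :=
    Finset.sum_nonneg fun S _ => mul_nonneg (bernWeight_nonneg hp' S) (sq_nonneg _)
  calc _ ≤ (∑ S, bernWeight p S * (R S - 1) ^ 2) * 1 := by gcongr
    _ ≤ _ := by
      rw [mul_one, h5]
      linarith

/-! ### The second moment method for cylinder events -/

lemma cylinderProb_nonneg {ι : Type*} [DecidableEq ι] {p : ι → ℝ}
    (hp : ∀ i, 0 ≤ p i ∧ p i ≤ 1) (F D : Finset ι) :
    0 ≤ cylinderProb p F D :=
  Finset.prod_nonneg fun i _ => by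
    split_ifs
    · exact (hp i).1
    · linarith [(hp i).2]

/-- If neither of two cylinder events requires an element that the other one excludes, then they are
correlated only through the elements that both of them exclude. -/
lemma bernProb_cylinder_inter_le {c : ℝ} (hp : ∀ i, 0 ≤ p i ∧ p i ≤ c) (hc0 : 0 ≤ c)
    (hc : c ≤ 1 / 8)
    {F D F' D' : Finset ι} (hD : D ⊆ F) (hD' : D' ⊆ F') (h : Disjoint D F') (h' : Disjoint D' F)
    (hcard : (F ∩ F').card ≤ 4) :
    bernProb p ({S | S ∩ F = D} ∩ {S | S ∩ F' = D'}) ≤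
      (1 + 8 * c) * (cylinderProb p F D * cylinderProb p F' D') := by
  have hp' : ∀ i, 0 ≤ p i ∧ p i ≤ 1 := fun i => ⟨(hp i).1, by linarith [(hp i).2]⟩
  have hsub : ({S | S ∩ F = D} ∩ {S | S ∩ F' = D'} : Set (Finset ι)) ⊆
      {S | S ∩ (F ∪ F') = D ∪ D'} := by
    rintro S ⟨h1, h2⟩
    simp only [Set.mem_ofPred_eq] at *
    rw [Finset.inter_union_distrib_left, h1, h2]
  refine (bernProb_mono hp' hsub).trans ?_
  rw [bernProb_cylinder p (Finset.union_subset_union hD hD')]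
  have h1 : cylinderProb p F D = ∏ i ∈ F, if i ∈ D ∪ D' then p i else 1 - p i :=
    Finset.prod_congr rfl fun i hi => by
      have : i ∉ D' := fun h2 => Finset.disjoint_left.1 h' h2 hi
      simp [this]
  have h2 : cylinderProb p F' D' = ∏ i ∈ F', if i ∈ D ∪ D' then p i else 1 - p i :=
    Finset.prod_congr rfl fun i hi => by
      have : i ∉ D := fun h2 => Finset.disjoint_left.1 h h2 hi
      simp [this]
  have h3 : (∏ i ∈ F ∩ F', if i ∈ D ∪ D' then p i else 1 - p i) = ∏ i ∈ F ∩ F', (1 - p i) :=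
    Finset.prod_congr rfl fun i hi => by
      rw [Finset.mem_inter] at hi
      have h4 : i ∉ D := fun h2 => Finset.disjoint_left.1 h h2 hi.2
      have h5 : i ∉ D' := fun h2 => Finset.disjoint_left.1 h' h2 hi.1
      simp [h4, h5]
  have h4 : 1 - 4 * c ≤ ∏ i ∈ F ∩ F', (1 - p i) :=
    calc 1 - 4 * c ≤ (1 - c) ^ 4 := by
          have := one_add_mul_le_pow (a := -c) (by linarith) 4
          push_cast at this
          linarith [this, sub_eq_add_neg 1 c ▸ this]
      _ ≤ (1 - c) ^ (F ∩ F').card :=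
          pow_le_pow_of_le_one (by linarith) (by linarith) hcard
      _ ≤ _ := by
          rw [← Finset.prod_const]
          exact Finset.prod_le_prod (fun i _ => by linarith) fun i _ => by linarith [(hp i).2]
  rw [h1, h2, ← Finset.prod_union_inter, h3]
  change cylinderProb p (F ∪ F') (D ∪ D') ≤
    (1 + 8 * c) * (cylinderProb p (F ∪ F') (D ∪ D') * _)
  have h5 := cylinderProb_nonneg hp' (F ∪ F') (D ∪ D')
  calc cylinderProb p (F ∪ F') (D ∪ D')
      ≤ cylinderProb p (F ∪ F') (D ∪ D') * ((1 + 8 * c) * (1 - 4 * c)) :=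
        le_mul_of_one_le_right h5 (by nlinarith)
    _ ≤ cylinderProb p (F ∪ F') (D ∪ D') * ((1 + 8 * c) * ∏ i ∈ F ∩ F', (1 - p i)) := by gcongr
    _ = _ := by ring

/-- Let `X` be the number of `α ∈ 𝒜` for which the random subset agrees with `D α` on `F α`, and
`m` its mean. Weakly correlated pairs make `X` concentrate around `m`, so that with high
probability some such `α` also avoids `bad α`, an event which is unlikely and independent
of what happens on `F α`. -/
lemma bernProb_forall_bad_le {κ : Type*} (hp : ∀ i, 0 ≤ p i ∧ p i ≤ 1) (𝒜 : Finset κ)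
    (F D : κ → Finset ι) (hD : ∀ α ∈ 𝒜, D α ⊆ F α) (bad : κ → Set (Finset ι)) {δ ε : ℝ}
    (hδ : 0 ≤ δ) (hbad : ∀ α ∈ 𝒜, bernProb p {S | S \ F α ∈ bad α} ≤ ε)
    (hpair : ∀ α ∈ 𝒜, ∀ α' ∈ 𝒜, α ≠ α' →
      bernProb p ({S | S ∩ F α = D α} ∩ {S | S ∩ F α' = D α'}) ≤
        (1 + δ) * (cylinderProb p (F α) (D α) * cylinderProb p (F α') (D α')))
    (hm : 0 < ∑ α ∈ 𝒜, cylinderProb p (F α) (D α)) :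
    bernProb p {S | ∀ α ∈ 𝒜, S ∩ F α = D α → S \ F α ∈ bad α} ≤
      4 / (∑ α ∈ 𝒜, cylinderProb p (F α) (D α)) + 4 * δ + 2 * ε := by
  classical
  set m := ∑ α ∈ 𝒜, cylinderProb p (F α) (D α) with hmdef
  let A : κ → Set (Finset ι) := fun α => {S | S ∩ F α = D α}
  let B : κ → Set (Finset ι) := fun α => {S | S \ F α ∈ bad α}
  let X : Finset ι → ℝ := fun S => ∑ α ∈ 𝒜, (A α).indicator 1 S
  let Y : Finset ι → ℝ := fun S => ∑ α ∈ 𝒜, (A α ∩ B α).indicator 1 S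
  have hA : ∀ α ∈ 𝒜, bernProb p (A α) = cylinderProb p (F α) (D α) := fun α hα =>
    bernProb_cylinder p (hD α hα)
  have hX : bernExp p X = m := by
    rw [bernExp_sum]
    exact Finset.sum_congr rfl hA
  have hY : bernExp p Y ≤ ε * m := by
    rw [bernExp_sum, hmdef, Finset.mul_sum]
    refine Finset.sum_le_sum fun α hα => ?_
    have h := bernProb_inter_of_disjoint p (F α) {D α} (bad α)
    change bernProb p (A α ∩ B α) = bernProb p (A α) * bernProb p (B α) at h
    change bernProb p (A α ∩ B α) ≤ _
    rw [h, hA α hα, mul_comm]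
    exact mul_le_mul_of_nonneg_right (hbad α hα) (cylinderProb_nonneg hp _ _)
  have hX2 : bernExp p (fun S => X S ^ 2) ≤ m + (1 + δ) * m ^ 2 := by
    have h : (fun S => X S ^ 2) =
        fun S => ∑ α ∈ 𝒜, ∑ α' ∈ 𝒜, (A α ∩ A α').indicator (1 : Finset ι → ℝ) S := by
      ext S
      simp only [X, sq, Finset.sum_mul_sum]
      refine Finset.sum_congr rfl fun α _ => Finset.sum_congr rfl fun α' _ => ?_
      by_cases h1 : S ∈ A α <;> by_cases h2 : S ∈ A α' <;> simp [h1, h2]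
    rw [h, bernExp_sum]
    have h2 : ∀ α ∈ 𝒜, bernExp p
        (fun S => ∑ α' ∈ 𝒜, (A α ∩ A α').indicator (1 : Finset ι → ℝ) S) ≤
        cylinderProb p (F α) (D α) + (1 + δ) * (cylinderProb p (F α) (D α) * m) := by
      intro α hα
      rw [bernExp_sum, ← Finset.add_sum_erase _ _ hα, Set.inter_self]
      refine add_le_add (hA α hα).le ?_
      calc _ ≤ ∑ α' ∈ 𝒜.erase α,
            (1 + δ) * (cylinderProb p (F α) (D α) * cylinderProb p (F α') (D α')) :=
            Finset.sum_le_sum fun α' hα' => hpair α hα α' (Finset.mem_of_mem_erase hα')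
              (Finset.ne_of_mem_erase hα').symm
        _ ≤ ∑ α' ∈ 𝒜,
            (1 + δ) * (cylinderProb p (F α) (D α) * cylinderProb p (F α') (D α')) :=
            Finset.sum_le_sum_of_subset_of_nonneg (Finset.erase_subset _ _) fun α' _ _ =>
              mul_nonneg (by linarith)
                (mul_nonneg (cylinderProb_nonneg hp _ _) (cylinderProb_nonneg hp _ _))
        _ = _ := by rw [← Finset.mul_sum, ← Finset.mul_sum]
    refine (Finset.sum_le_sum h2).trans (le_of_eq ?_)
    rw [Finset.sum_add_distrib, ← Finset.mul_sum, ← Finset.sum_mul, ← hmdef]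
    ring
  have hVar : bernExp p (fun S => (X S - m) ^ 2) ≤ m + δ * m ^ 2 := by
    have h : (fun S => (X S - m) ^ 2) = fun S => X S ^ 2 + (-(2 * m) * X S + m ^ 2) := by
      ext S
      ring
    rw [h, bernExp_add, bernExp_add, bernExp_const_mul, bernExp_const, hX]
    nlinarith
  -- If every `α` that occurs is bad then `X = Y`, so either `X` is below half its mean, or `Y`
  -- is above half the mean of `X`.
  have hpoint : ∀ S, ({S | ∀ α ∈ 𝒜, S ∩ F α = D α → S \ F α ∈ bad α} :
      Set (Finset ι)).indicator (1 : Finset ι → ℝ) S ≤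
      4 / m ^ 2 * (X S - m) ^ 2 + 2 / m * Y S := by
    intro S
    have hY0 : 0 ≤ Y S :=
      Finset.sum_nonneg fun α _ => Set.indicator_nonneg (fun _ _ => zero_le_one) S
    by_cases hS : ∀ α ∈ 𝒜, S ∩ F α = D α → S \ F α ∈ bad α
    · rw [Set.indicator_of_mem (by exact hS), Pi.one_apply]
      have hXY : Y S = X S := by
        refine Finset.sum_congr rfl fun α hα => ?_
        by_cases h1 : S ∈ A α
        · have h2 : S ∈ B α := hS α hα h1
          simp [h1, h2]
        · simp [h1]
      rcases le_total (X S) (m / 2) with h | h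
      · have h1 : 1 ≤ 4 / m ^ 2 * (X S - m) ^ 2 := by
          rw [div_mul_eq_mul_div, le_div_iff₀ (by positivity)]
          nlinarith
        have h2 : 0 ≤ 2 / m * Y S := by positivity
        linarith
      · have h1 : 1 ≤ 2 / m * Y S := by
          rw [div_mul_eq_mul_div, le_div_iff₀ (by positivity), hXY]
          linarith
        have h2 : 0 ≤ 4 / m ^ 2 * (X S - m) ^ 2 := by positivity
        linarith
    · rw [Set.indicator_of_notMem (by exact hS)]
      positivity
  calc _ ≤ bernExp p (fun S => 4 / m ^ 2 * (X S - m) ^ 2 + 2 / m * Y S) := bernExp_mono hp hpoint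
    _ = 4 / m ^ 2 * bernExp p (fun S => (X S - m) ^ 2) + 2 / m * bernExp p Y := by
        rw [bernExp_add, bernExp_const_mul, bernExp_const_mul]
    _ ≤ 4 / m ^ 2 * (m + δ * m ^ 2) + 2 / m * (ε * m) := by gcongr
    _ = _ := by field_simp

end RandomSubset

/-! ### Trails in a random set of edges -/

section Trail

variable {V : Type*} [DecidableEq V]

/-- The edge sets `S` that contain a trail of length `k` which starts at `u` and ends at a vertex
`w` such that the edges of `S` not used by the trail have the property `Q w`. Loops may be used
as edges. -/
def TrailTo (Q : V → Set (Finset (Sym2 V))) : ℕ → V → Set (Finset (Sym2 V))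
  | 0, u => Q u
  | k + 1, u => {S | ∃ w, s(u, w) ∈ S ∧ S.erase s(u, w) ∈ TrailTo Q k w}

/-- The edge sets that contain a trail of positive length from `u` to `v`. -/
def TrailBetween (u v : V) : Set (Finset (Sym2 V)) :=
  {S | ∃ k, S ∈ TrailTo (fun w => {_T | w = v}) (k + 1) u}

/-- The edge sets that contain a trail from `u` to some vertex `w`, followed by a closed trail of
positive length at `w` that uses other edges. -/
def Lasso (u : V) : Set (Finset (Sym2 V)) :=
  {S | ∃ k, S ∈ TrailTo (fun w => TrailBetween w w) k u}

lemma isUpperSet_trailTo {Q : V → Set (Finset (Sym2 V))} (hQ : ∀ w, IsUpperSet (Q w)) (k : ℕ)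
    (u : V) : IsUpperSet (TrailTo Q k u) := by
  induction k generalizing u with
  | zero => exact hQ u
  | succ k ih =>
    rintro S T hST ⟨w, hw, h⟩
    exact ⟨w, hST hw, ih w (Finset.erase_subset_erase _ hST) h⟩

lemma isUpperSet_trailBetween (u v : V) : IsUpperSet (TrailBetween u v) := by
  rintro S T hST ⟨k, h⟩
  exact ⟨k, isUpperSet_trailTo (fun w => fun _ _ _ h => h) _ _ hST h⟩

lemma isUpperSet_lasso (u : V) : IsUpperSet (Lasso u) := by
  rintro S T hST ⟨k, h⟩
  exact ⟨k, isUpperSet_trailTo (fun w => isUpperSet_trailBetween w w) _ _ hST h⟩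

lemma le_card_of_mem_trailTo {Q : V → Set (Finset (Sym2 V))} {k : ℕ} {u : V}
    {S : Finset (Sym2 V)} (h : S ∈ TrailTo Q k u) : k ≤ S.card := by
  induction k generalizing u S with
  | zero => exact Nat.zero_le _
  | succ k ih =>
    obtain ⟨w, hw, h⟩ := h
    have h1 := ih h
    have h2 := Finset.card_erase_add_one hw
    omega

lemma mem_trailTo_of_isTrail {H : SimpleGraph V} {u v : V} (P : H.Walk u v) (hP : P.IsTrail)
    {S : Finset (Sym2 V)} (hS : ∀ e ∈ P.edges, e ∈ S) :
    S ∈ TrailTo (fun w => {_T | w = v}) P.length u := by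
  induction P generalizing S with
  | nil => rfl
  | cons h P ih =>
    rw [SimpleGraph.Walk.isTrail_cons] at hP
    simp only [SimpleGraph.Walk.edges_cons, List.mem_cons, forall_eq_or_imp] at hS
    refine ⟨_, hS.1, ih hP.1 fun e he => Finset.mem_erase.2 ⟨?_, hS.2 e he⟩⟩
    rintro rfl
    exact hP.2 he

lemma mem_trailBetween_of_isTrail {H : SimpleGraph V} {u v : V} (P : H.Walk u v)
    (hP : P.IsTrail) (hne : P.length ≠ 0) {S : Finset (Sym2 V)} (hS : ∀ e ∈ P.edges, e ∈ S) :
    S ∈ TrailBetween u v := by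
  obtain ⟨k, hk⟩ := Nat.exists_eq_succ_of_ne_zero hne
  have h := mem_trailTo_of_isTrail P hP hS
  rw [hk] at h
  exact ⟨k, h⟩

/-- Following a path up to the first vertex of a cycle gives a lasso. -/
lemma mem_lasso_of_isCycle {H : SimpleGraph V} {w : V} (C : H.Walk w w) (hC : C.IsCycle)
    {u v : V} (P : H.Walk u v) (hP : P.IsPath) (hv : v ∈ C.support) {S : Finset (Sym2 V)}
    (hS : ∀ e ∈ P.edges, e ∈ S) (hSC : ∀ e ∈ C.edges, e ∈ S) : S ∈ Lasso u := by
  have base : ∀ {T : Finset (Sym2 V)} {z : V}, (∀ e ∈ C.edges, e ∈ T) → z ∈ C.support →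
      T ∈ Lasso z := fun {T z} hT hz => by
    refine ⟨0, mem_trailBetween_of_isTrail (C.rotate z hz) (hC.rotate hz).isTrail ?_ fun e he =>
      hT e ((C.rotate_edges z hz).mem_iff.1 he)⟩
    rw [SimpleGraph.Walk.length_rotate]
    have := hC.three_le_length
    omega
  induction P generalizing S with
  | nil => exact base hSC hv
  | @cons u a v h P ih =>
    by_cases hu : u ∈ C.support
    · exact base hSC hu
    rw [SimpleGraph.Walk.cons_isPath_iff] at hP
    simp only [SimpleGraph.Walk.edges_cons, List.mem_cons, forall_eq_or_imp] at hS
    have h1 : ∀ e ∈ P.edges, e ∈ S.erase s(u, a) := fun e he => by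
      refine Finset.mem_erase.2 ⟨?_, hS.2 e he⟩
      rintro rfl
      exact hP.2 (P.fst_mem_support_of_mem_edges he)
    have h2 : ∀ e ∈ C.edges, e ∈ S.erase s(u, a) := fun e he => by
      refine Finset.mem_erase.2 ⟨?_, hSC e he⟩
      rintro rfl
      exact hu (C.fst_mem_support_of_mem_edges he)
    obtain ⟨k, hk⟩ := ih hP.1 hv h1 h2
    exact ⟨k + 1, a, hS.1, hk⟩

variable [Fintype V] {p : Sym2 V → ℝ} {c : ℝ} {x : V → ℝ}

lemma bernProb_trailTo_succ_le (hp : ∀ e, 0 ≤ p e ∧ p e ≤ 1) {Q : V → Set (Finset (Sym2 V))}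
    (hQ : ∀ w, IsUpperSet (Q w)) (k : ℕ) (u : V) :
    bernProb p (TrailTo Q (k + 1) u) ≤ ∑ w, p s(u, w) * bernProb p (TrailTo Q k w) := by
  refine (bernProb_iUnion_le hp Finset.univ _
    (fun w => {S | s(u, w) ∈ S ∧ S.erase s(u, w) ∈ TrailTo Q k w}) ?_).trans
    (Finset.sum_le_sum fun w _ => bernProb_mem_erase_le hp _ (isUpperSet_trailTo hQ k w))
  rintro S ⟨w, hw⟩
  exact ⟨w, Finset.mem_univ w, hw⟩

/-- For edge probabilities of rank one, the expected number of trails is a geometric sequence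
with ratio `c ∑ x²`. -/
lemma bernProb_trailTo_le (hp : ∀ e, 0 ≤ p e ∧ p e ≤ 1) (hc : 0 ≤ c) (hx : ∀ v, 0 ≤ x v)
    (hpx : ∀ u v, p s(u, v) ≤ c * x u * x v) {Q : V → Set (Finset (Sym2 V))}
    (hQ : ∀ w, IsUpperSet (Q w)) (k : ℕ) (u : V) :
    bernProb p (TrailTo Q (k + 1) u) ≤
      c * x u * (c * ∑ v, x v ^ 2) ^ k * ∑ w, x w * bernProb p (Q w) := by
  induction k generalizing u with
  | zero =>
    refine (bernProb_trailTo_succ_le hp hQ 0 u).trans ?_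
    rw [pow_zero, mul_one, Finset.mul_sum]
    refine Finset.sum_le_sum fun w _ => ?_
    rw [← mul_assoc]
    exact mul_le_mul_of_nonneg_right (hpx u w) (bernProb_nonneg hp _)
  | succ k ih =>
    refine (bernProb_trailTo_succ_le hp hQ (k + 1) u).trans ?_
    set B := ∑ w, x w * bernProb p (Q w)
    set ρ := c * ∑ v, x v ^ 2 with hρ
    calc _ ≤ ∑ w, (c * x u * x w) * (c * x w * ρ ^ k * B) :=
          Finset.sum_le_sum fun w _ => mul_le_mul (hpx u w) (ih w) (bernProb_nonneg hp _)
            (mul_nonneg (mul_nonneg hc (hx u)) (hx w))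
      _ = ∑ w, (c * x u * ρ ^ k * B * c) * x w ^ 2 :=
          Finset.sum_congr rfl fun w _ => by ring
      _ = c * x u * ρ ^ (k + 1) * B := by
          rw [← Finset.mul_sum, pow_succ]
          nth_rewrite 3 [hρ]
          ring

lemma bernProb_exists_trailTo_le (hp : ∀ e, 0 ≤ p e ∧ p e ≤ 1) (hc : 0 ≤ c) (hx : ∀ v, 0 ≤ x v)
    (hpx : ∀ u v, p s(u, v) ≤ c * x u * x v) {r : ℝ} (hr : c * ∑ v, x v ^ 2 ≤ r) (hr1 : r < 1)
    {Q : V → Set (Finset (Sym2 V))} (hQ : ∀ w, IsUpperSet (Q w)) (u : V) :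
    bernProb p {S | ∃ k, S ∈ TrailTo Q (k + 1) u} ≤
      c * x u / (1 - r) * ∑ w, x w * bernProb p (Q w) := by
  set ρ := c * ∑ v, x v ^ 2 with hρ
  have hρ0 : 0 ≤ ρ := mul_nonneg hc (Finset.sum_nonneg fun v _ => sq_nonneg _)
  have hB : 0 ≤ ∑ w, x w * bernProb p (Q w) :=
    Finset.sum_nonneg fun w _ => mul_nonneg (hx w) (bernProb_nonneg hp _)
  have hgeom : ∑ k ∈ Finset.range (Fintype.card (Sym2 V)), ρ ^ k ≤ 1 / (1 - r) := by
    rw [le_div_iff₀ (by linarith)]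
    have h1 := mul_neg_geom_sum ρ (Fintype.card (Sym2 V))
    have h2 : 0 ≤ ∑ k ∈ Finset.range (Fintype.card (Sym2 V)), ρ ^ k :=
      Finset.sum_nonneg fun k _ => pow_nonneg hρ0 k
    have h3 : 0 ≤ ρ ^ Fintype.card (Sym2 V) := pow_nonneg hρ0 _
    nlinarith
  calc _ ≤ ∑ k ∈ Finset.range (Fintype.card (Sym2 V)), bernProb p (TrailTo Q (k + 1) u) := by
        refine bernProb_iUnion_le hp _ _ _ ?_
        rintro S ⟨k, hk⟩
        refine ⟨k, Finset.mem_range.2 ?_, hk⟩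
        have h1 := le_card_of_mem_trailTo hk
        have h2 := Finset.card_le_univ S
        omega
    _ ≤ ∑ k ∈ Finset.range (Fintype.card (Sym2 V)),
          c * x u * ρ ^ k * ∑ w, x w * bernProb p (Q w) :=
        Finset.sum_le_sum fun k _ => bernProb_trailTo_le hp hc hx hpx hQ k u
    _ = c * x u * (∑ w, x w * bernProb p (Q w)) *
          ∑ k ∈ Finset.range (Fintype.card (Sym2 V)), ρ ^ k := by
        rw [Finset.mul_sum]
        exact Finset.sum_congr rfl fun k _ => by ring
    _ ≤ c * x u * (∑ w, x w * bernProb p (Q w)) * (1 / (1 - r)) :=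
        mul_le_mul_of_nonneg_left hgeom (mul_nonneg (mul_nonneg hc (hx u)) hB)
    _ = _ := by ring

lemma bernProb_trailBetween_le (hp : ∀ e, 0 ≤ p e ∧ p e ≤ 1) (hc : 0 ≤ c) (hx : ∀ v, 0 ≤ x v)
    (hpx : ∀ u v, p s(u, v) ≤ c * x u * x v) {r : ℝ} (hr : c * ∑ v, x v ^ 2 ≤ r) (hr1 : r < 1)
    (u v : V) : bernProb p (TrailBetween u v) ≤ c * x u * x v / (1 - r) := by
  refine (bernProb_exists_trailTo_le hp hc hx hpx hr hr1
    (fun w => fun _ _ _ h => h) u).trans (le_of_eq ?_)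
  rw [Finset.sum_eq_single v]
  · have : bernProb p {_T | v = v} = 1 := by
      rw [← bernExp_const p 1, bernProb]
      congr 1
      ext S
      simp [Set.indicator]
    rw [this]
    ring
  · intro w _ hw
    have : bernProb p {_T | w = v} = 0 := by
      rw [← bernExp_const p 0, bernProb]
      congr 1
      ext S
      simp [Set.indicator, hw]
    rw [this, mul_zero]
  · simp

lemma bernProb_lasso_le (hp : ∀ e, 0 ≤ p e ∧ p e ≤ 1) (hc : 0 ≤ c)
    (hx : ∀ v, 0 ≤ x v ∧ x v ≤ 1) (hpx : ∀ u v, p s(u, v) ≤ c * x u * x v) {r : ℝ}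
    (hr : c * ∑ v, x v ^ 2 ≤ r) (hr1 : r < 1) (u : V) :
    bernProb p (Lasso u) ≤ 2 * c / (1 - r) ^ 2 := by
  have hx0 : ∀ v, 0 ≤ x v := fun v => (hx v).1
  have h1r : 0 < 1 - r := by linarith
  have hr0 : 0 ≤ r :=
    le_trans (mul_nonneg hc (Finset.sum_nonneg fun v _ => sq_nonneg (x v))) hr
  have hsplit : Lasso u ⊆ TrailBetween u u ∪
      {S | ∃ k, S ∈ TrailTo (fun w => TrailBetween w w) (k + 1) u} := by
    rintro S ⟨k, hk⟩
    cases k with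
    | zero => exact Or.inl hk
    | succ k => exact Or.inr ⟨k, hk⟩
  have hclosed : ∀ w, bernProb p (TrailBetween w w) ≤ c * x w / (1 - r) := fun w =>
    (bernProb_trailBetween_le hp hc hx0 hpx hr hr1 w w).trans
      (div_le_div_of_nonneg_right (mul_le_of_le_one_right (mul_nonneg hc (hx0 w)) (hx w).2) h1r.le)
  have hsum : ∑ w, x w * bernProb p (TrailBetween w w) ≤ r / (1 - r) :=
    calc _ ≤ ∑ w, x w * (c * x w / (1 - r)) :=
          Finset.sum_le_sum fun w _ => mul_le_mul_of_nonneg_left (hclosed w) (hx0 w)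
      _ = (c * ∑ w, x w ^ 2) / (1 - r) := by
          rw [Finset.mul_sum, Finset.sum_div]
          exact Finset.sum_congr rfl fun w _ => by ring
      _ ≤ _ := by gcongr
  have hcu : c * x u ≤ c := mul_le_of_le_one_right hc (hx u).2
  have hsum0 : 0 ≤ ∑ w, x w * bernProb p (TrailBetween w w) :=
    Finset.sum_nonneg fun w _ => mul_nonneg (hx0 w) (bernProb_nonneg hp _)
  calc _ ≤ bernProb p (TrailBetween u u) +
        bernProb p {S | ∃ k, S ∈ TrailTo (fun w => TrailBetween w w) (k + 1) u} :=
        (bernProb_mono hp hsplit).trans (bernProb_union_le hp _ _)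
    _ ≤ c / (1 - r) + c / (1 - r) * (r / (1 - r)) := by
        refine add_le_add ((hclosed u).trans (by gcongr)) ?_
        refine (bernProb_exists_trailTo_le hp hc hx0 hpx hr hr1
          (fun w => isUpperSet_trailBetween w w) u).trans ?_
        gcongr
    _ = c / (1 - r) ^ 2 := by
        field_simp
        ring
    _ ≤ _ := by
        gcongr
        linarith

end Trail

/-! ### Adding a double star to a forest -/

section Graph

variable {V : Type*} [Fintype V] [DecidableEq V]

/-- The pairs of vertices that contain `a` or `b`. -/
def pairsTouching (a b : V) : Finset (Sym2 V) := Finset.univ.filter fun e => a ∈ e ∨ b ∈ e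

/-- The edges of the path `(v₁, v₂, v₃, v₄)`. -/
def pathEdges (v₁ v₂ v₃ v₄ : V) : Finset (Sym2 V) := {s(v₁, v₂), s(v₂, v₃), s(v₃, v₄)}

/-- The pairs that consist of `v` and a vertex other than `v`, `a` and `b`. -/
def starPairs (v a b : V) : Finset (Sym2 V) :=
  (Finset.univ \ {v, a, b}).image fun w => s(v, w)

lemma SimpleGraph.not_reachable_of_closed {V : Type*} {G : SimpleGraph V} (Z : Set V)
    (hZ : ∀ a b, G.Adj a b → a ∈ Z → b ∈ Z) {u v : V} (hu : u ∈ Z) (hv : v ∉ Z) :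
    ¬ G.Reachable u v := by
  rintro ⟨P⟩
  induction P with
  | nil => exact hv hu
  | cons h P ih => exact ih (hZ _ _ h hu) hv

lemma pathEdges_subset_pairsTouching (v₁ v₂ v₃ v₄ : V) :
    pathEdges v₁ v₂ v₃ v₄ ⊆ pairsTouching v₂ v₃ := by
  intro e he
  simp only [pathEdges, Finset.mem_insert, Finset.mem_singleton] at he
  rcases he with rfl | rfl | rfl <;> simp [pairsTouching]

lemma card_inter_starPairs (S : Finset (Sym2 V)) (v a b : V) :
    (S ∩ starPairs v a b).card = {w | s(v, w) ∈ S ∧ w ≠ v ∧ w ≠ a ∧ w ≠ b}.ncard := by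
  have h : {w | s(v, w) ∈ S ∧ w ≠ v ∧ w ≠ a ∧ w ≠ b} =
      ((Finset.univ \ {v, a, b}).filter fun w => s(v, w) ∈ S : Finset V) := by
    ext w
    simp only [Finset.coe_filter, Finset.mem_sdiff, Finset.mem_univ, true_and, Finset.mem_insert,
      Finset.mem_singleton, Set.mem_ofPred_eq, not_or]
    tauto
  rw [h, Set.ncard_coe_finset, starPairs, Finset.inter_comm, ← Finset.filter_mem_eq_inter,
    Finset.filter_image, Finset.card_image_of_injective]
  exact fun w w' hw => Sym2.congr_right.1 hw

section DoubleStar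

variable {S : Finset (Sym2 V)} {v₁ v₂ v₃ v₄ : V}

lemma adj_of_inter_pairsTouching (hd : [v₁, v₂, v₃, v₄].Nodup)
    (hS : S ∩ pairsTouching v₂ v₃ = pathEdges v₁ v₂ v₃ v₄) :
    (∀ b, s(v₂, b) ∈ S ↔ b = v₁ ∨ b = v₃) ∧ (∀ b, s(v₃, b) ∈ S ↔ b = v₂ ∨ b = v₄) := by
  simp only [List.nodup_cons, List.mem_cons, List.not_mem_nil, or_false, not_or, not_false_eq_true,
    List.nodup_nil, and_true] at hd
  obtain ⟨⟨h12, h13, h14⟩, ⟨h23, h24⟩, h34⟩ := hd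
  have key : ∀ e : Sym2 V, (v₂ ∈ e ∨ v₃ ∈ e) → (e ∈ S ↔ e ∈ pathEdges v₁ v₂ v₃ v₄) := by
    intro e he
    rw [← hS, Finset.mem_inter]
    simp [pairsTouching, he]
  constructor <;> intro b
  · rw [key _ (by simp)]
    simp only [pathEdges, Finset.mem_insert, Finset.mem_singleton, Sym2.eq_iff]
    grind
  · rw [key _ (by simp)]
    simp only [pathEdges, Finset.mem_insert, Finset.mem_singleton, Sym2.eq_iff]
    grind

lemma vertexDegree_endpoint {N : ℕ} {S : Finset (Sym2 (Fin N))} {v a b : Fin N} (hva : v ≠ a)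
    (ha : s(v, a) ∈ S) (hb : s(v, b) ∉ S) :
    vertexDegree (SimpleGraph.fromEdgeSet (S : Set (Sym2 (Fin N)))) v =
      (S ∩ starPairs v a b).card + 1 := by
  rw [card_inter_starPairs, vertexDegree, ← Set.ncard_insert_of_notMem (a := a) (by simp)]
  congr 1
  ext w
  simp only [SimpleGraph.mem_neighborSet, SimpleGraph.fromEdgeSet_adj, Finset.mem_coe,
    Set.mem_insert_iff, Set.mem_ofPred_eq]
  constructor
  · rintro ⟨h1, h2⟩
    by_cases hwa : w = a
    · exact Or.inl hwa
    · refine Or.inr ⟨h1, h2.symm, hwa, ?_⟩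
      rintro rfl
      exact hb h1
  · rintro (rfl | ⟨h1, h2, -, -⟩)
    · exact ⟨ha, hva⟩
    · exact ⟨h1, h2.symm⟩

/-- If deleting `v₂` and `v₃` leaves `v₁` and `v₄` in two different components that are trees, then
the component containing the path `(v₁, v₂, v₃, v₄)` is a tree. -/
lemma isTree_of_forall_notMem_lasso (hd : [v₁, v₂, v₃, v₄].Nodup)
    (hS : S ∩ pairsTouching v₂ v₃ = pathEdges v₁ v₂ v₃ v₄)
    (h14 : S \ pairsTouching v₂ v₃ ∉ TrailBetween v₁ v₄)
    (h1 : S \ pairsTouching v₂ v₃ ∉ Lasso v₁) (h4 : S \ pairsTouching v₂ v₃ ∉ Lasso v₄) :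
    let G := SimpleGraph.fromEdgeSet (S : Set (Sym2 V))
    (G.induce (G.connectedComponentMk v₁).supp).IsTree := by
  intro G
  obtain ⟨hv2, hv3⟩ := adj_of_inter_pairsTouching hd hS
  simp only [List.nodup_cons, List.mem_cons, List.not_mem_nil, or_false, not_or, not_false_eq_true,
    List.nodup_nil, and_true] at hd
  obtain ⟨⟨n12, n13, n14⟩, ⟨n23, n24⟩, n34⟩ := hd
  set S' := S \ pairsTouching v₂ v₃ with hS'
  let H : SimpleGraph V := SimpleGraph.fromEdgeSet (S' : Set (Sym2 V))
  have hHS : ∀ {a b : V} (P : H.Walk a b), ∀ e ∈ P.edges, e ∈ S' := fun P e he => by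
    have := P.edges_subset_edgeSet he
    rw [SimpleGraph.edgeSet_fromEdgeSet] at this
    exact this.1
  have hHG : ∀ a b, H.Adj a b ↔
      G.Adj a b ∧ a ≠ v₂ ∧ a ≠ v₃ ∧ b ≠ v₂ ∧ b ≠ v₃ := by
    intro a b
    simp only [H, G, SimpleGraph.fromEdgeSet_adj, Finset.mem_coe, hS', Finset.mem_sdiff,
      pairsTouching, Finset.mem_filter, Finset.mem_univ, true_and, Sym2.mem_iff]
    grind
  have g2 : ∀ b, G.Adj v₂ b ↔ b = v₁ ∨ b = v₃ := fun b => by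
    simp only [G, SimpleGraph.fromEdgeSet_adj, Finset.mem_coe, hv2]
    grind
  have g3 : ∀ b, G.Adj v₃ b ↔ b = v₂ ∨ b = v₄ := fun b => by
    simp only [G, SimpleGraph.fromEdgeSet_adj, Finset.mem_coe, hv3]
    grind
  -- `H₁` is the part of `H` in the components of `v₁` and `v₄`.
  let H₁ : SimpleGraph V :=
    { Adj := fun a b => H.Adj a b ∧ (H.Reachable v₁ a ∨ H.Reachable v₄ a)
      symm := ⟨fun a b h => ⟨h.1.symm, h.2.imp (fun h' => h'.trans h.1.reachable)
        (fun h' => h'.trans h.1.reachable)⟩⟩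
      loopless := ⟨fun a h => h.1.ne rfl⟩ }
  have hH₁ : H₁.IsAcyclic := by
    intro w C hC
    have hle : H₁ ≤ H := fun a b h => h.1
    have hw : H.Reachable v₁ w ∨ H.Reachable v₄ w := by
      cases C with
      | nil => exact absurd rfl hC.ne_nil
      | cons h _ => exact h.2
    have hC' := hC.mapLe hle
    rcases hw with hw | hw
    · obtain ⟨P, hP⟩ := hw.exists_isPath
      exact h1 (mem_lasso_of_isCycle _ hC' P hP (SimpleGraph.Walk.start_mem_support _)
        (hHS P) (hHS _))
    · obtain ⟨P, hP⟩ := hw.exists_isPath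
      exact h4 (mem_lasso_of_isCycle _ hC' P hP (SimpleGraph.Walk.start_mem_support _)
        (hHS P) (hHS _))
  have hH14 : ¬ H.Reachable v₁ v₄ := fun h => by
    obtain ⟨P, hP⟩ := h.exists_isPath
    refine h14 (mem_trailBetween_of_isTrail P hP.isTrail ?_ (hHS P))
    intro h0
    exact n14 (SimpleGraph.Walk.eq_of_length_eq_zero h0)
  have hG1 : (H₁ ⊔ SimpleGraph.edge v₁ v₂).IsAcyclic := by
    refine hH₁.sup_edge_of_not_reachable fun h => ?_
    refine SimpleGraph.not_reachable_of_closed {v₂} ?_ rfl (by simpa using n12) h.symm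
    rintro a b hab rfl
    exact absurd rfl ((hHG _ _).1 hab.1).2.1
  have hG2 : (H₁ ⊔ SimpleGraph.edge v₁ v₂ ⊔ SimpleGraph.edge v₂ v₃).IsAcyclic := by
    refine hG1.sup_edge_of_not_reachable fun h => ?_
    refine SimpleGraph.not_reachable_of_closed {v₃} ?_ rfl (by simpa using n23) h.symm
    rintro a b hab rfl
    rw [SimpleGraph.sup_adj, SimpleGraph.edge_adj] at hab
    rcases hab with hab | hab
    · exact absurd rfl ((hHG _ _).1 hab.1).2.2.1
    · grind
  have hG3 : (H₁ ⊔ SimpleGraph.edge v₁ v₂ ⊔ SimpleGraph.edge v₂ v₃ ⊔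
      SimpleGraph.edge v₃ v₄).IsAcyclic := by
    refine hG2.sup_edge_of_not_reachable ?_
    refine SimpleGraph.not_reachable_of_closed ({v₂, v₃} ∪ {a | H.Reachable v₁ a}) ?_
      (by simp) (by simp [Ne.symm n24, Ne.symm n34, hH14])
    intro a b hab ha
    simp only [SimpleGraph.sup_adj, SimpleGraph.edge_adj] at hab
    rcases hab with (hab | hab) | hab
    · have h5 := (hHG _ _).1 hab.1
      rcases ha with ha | ha
      · simp only [Set.mem_insert_iff, Set.mem_singleton_iff] at ha
        tauto
      · exact Or.inr (SimpleGraph.Reachable.trans ha hab.1.reachable)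
    · rcases hab.1 with ⟨-, rfl⟩ | ⟨-, rfl⟩
      · simp
      · exact Or.inr (SimpleGraph.Reachable.refl _)
    · rcases hab.1 with ⟨-, rfl⟩ | ⟨-, rfl⟩ <;> simp
  have hZ : ∀ a ∈ (G.connectedComponentMk v₁).supp,
      a = v₂ ∨ a = v₃ ∨ H.Reachable v₁ a ∨ H.Reachable v₄ a := by
    intro a ha
    by_contra hcon
    refine SimpleGraph.not_reachable_of_closed (G := G)
      {a | a = v₂ ∨ a = v₃ ∨ H.Reachable v₁ a ∨ H.Reachable v₄ a} ?_
      (Or.inr (Or.inr (Or.inl (SimpleGraph.Reachable.refl v₁)))) hcon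
      (SimpleGraph.ConnectedComponent.exact ha).symm
    intro a b hab ha
    by_cases ha2 : a = v₂
    · subst ha2
      rcases (g2 b).1 hab with rfl | rfl
      · exact Or.inr (Or.inr (Or.inl (SimpleGraph.Reachable.refl _)))
      · exact Or.inr (Or.inl rfl)
    by_cases ha3 : a = v₃
    · subst ha3
      rcases (g3 b).1 hab with rfl | rfl
      · exact Or.inl rfl
      · exact Or.inr (Or.inr (Or.inr (SimpleGraph.Reachable.refl _)))
    by_cases hb2 : b = v₂
    · exact Or.inl hb2
    by_cases hb3 : b = v₃
    · exact Or.inr (Or.inl hb3)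
    have hab' : H.Adj a b := (hHG a b).2 ⟨hab, ha2, ha3, hb2, hb3⟩
    rcases ha with ha | ha | ha | ha
    · exact absurd ha ha2
    · exact absurd ha ha3
    · exact Or.inr (Or.inr (Or.inl (ha.trans hab'.reachable)))
    · exact Or.inr (Or.inr (Or.inr (ha.trans hab'.reachable)))
  refine ⟨SimpleGraph.ConnectedComponent.connected_toSimpleGraph _, ?_⟩
  refine hG3.comap (G := G.induce (G.connectedComponentMk v₁).supp)
    ⟨Subtype.val, fun {a b} hab => ?_⟩ Subtype.val_injective
  replace hab : G.Adj a.1 b.1 := hab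
  have ha := hZ a.1 a.2
  generalize (a : V) = a at *
  generalize (b : V) = b at *
  simp only [SimpleGraph.sup_adj, SimpleGraph.edge_adj]
  have hne := hab.ne
  by_cases ha2 : a = v₂
  · rcases (g2 b).1 (ha2 ▸ hab) with hb | hb
    · exact Or.inl (Or.inl (Or.inr ⟨Or.inr ⟨ha2, hb⟩, hne⟩))
    · exact Or.inl (Or.inr ⟨Or.inl ⟨ha2, hb⟩, hne⟩)
  by_cases ha3 : a = v₃
  · rcases (g3 b).1 (ha3 ▸ hab) with hb | hb
    · exact Or.inl (Or.inr ⟨Or.inr ⟨ha3, hb⟩, hne⟩)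
    · exact Or.inr ⟨Or.inl ⟨ha3, hb⟩, hne⟩
  by_cases hb2 : b = v₂
  · rcases (g2 a).1 (hb2 ▸ hab.symm) with h | h
    · exact Or.inl (Or.inl (Or.inr ⟨Or.inl ⟨h, hb2⟩, hne⟩))
    · exact absurd h ha3
  by_cases hb3 : b = v₃
  · rcases (g3 a).1 (hb3 ▸ hab.symm) with h | h
    · exact absurd h ha2
    · exact Or.inr ⟨Or.inr ⟨h, hb3⟩, hne⟩
  refine Or.inl (Or.inl (Or.inl ⟨(hHG a b).2 ⟨hab, ha2, ha3, hb2, hb3⟩, ?_⟩))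
  exact (ha.resolve_left ha2).resolve_left ha3

end DoubleStar

end Graph

/-! ### The edge set of an inhomogeneous random graph -/

section EdgeSet

open Classical in
/-- The edge set of a graph on a finite set of vertices. -/
def edgesOf {V : Type*} [Fintype V] (G : SimpleGraph V) : Finset (Sym2 V) :=
  Finset.univ.filter fun e => e ∈ G.edgeSet

lemma mem_edgesOf {V : Type*} [Fintype V] (G : SimpleGraph V) (e : Sym2 V) :
    e ∈ edgesOf G ↔ e ∈ G.edgeSet := by
  simp [edgesOf]

lemma fromEdgeSet_edgesOf {V : Type*} [Fintype V] (G : SimpleGraph V) :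
    SimpleGraph.fromEdgeSet (edgesOf G : Set (Sym2 V)) = G := by
  rw [show (edgesOf G : Set (Sym2 V)) = G.edgeSet by ext e; simp [mem_edgesOf],
    SimpleGraph.fromEdgeSet_edgeSet]

variable {N : ℕ} {Ω : Type*} [MeasurableSpace Ω] {μ : Measure Ω} [IsProbabilityMeasure μ]
  {q : Fin N → Fin N → ℝ} {G : Ω → SimpleGraph (Fin N)}

lemma IsInhomogeneousRandomGraph.measureReal_edgesOf_eq (hG : IsInhomogeneousRandomGraph μ q G)
    (T : Finset (Sym2 (Fin N))) :
    MeasurableSet {ω | edgesOf (G ω) = T} ∧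
    μ.real {ω | edgesOf (G ω) = T} =
      bernWeight (fun e => μ.real {ω | e ∈ (G ω).edgeSet}) T := by
  classical
  by_cases hdiag : ∃ e ∈ T, e.IsDiag
  · obtain ⟨e, heT, he⟩ := hdiag
    have h1 : ∀ ω, e ∉ (G ω).edgeSet := fun ω h =>
      (G ω).not_isDiag_of_mem_edgeSet h he
    have h2 : {ω | edgesOf (G ω) = T} = ∅ := by
      ext ω
      simp only [Set.mem_ofPred_eq, Set.mem_empty_iff_false, iff_false]
      rintro rfl
      exact h1 ω ((mem_edgesOf _ _).1 heT)
    refine ⟨by rw [h2]; exact MeasurableSet.empty, ?_⟩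
    rw [h2, measureReal_empty, bernWeight]
    symm
    refine Finset.prod_eq_zero (Finset.mem_univ e) ?_
    rw [if_pos heT]
    simp [h1]
  · push Not at hdiag
    let E := {e : Fin N × Fin N // e.1 < e.2}
    let φ : E → Sym2 (Fin N) := fun e => s(e.1.1, e.1.2)
    have hφ : Function.Injective φ := by
      rintro ⟨⟨a, b⟩, hab⟩ ⟨⟨a', b'⟩, hab'⟩ h
      simp only [φ, Sym2.eq_iff] at h
      simp only at hab hab'
      rcases h with ⟨rfl, rfl⟩ | ⟨rfl, rfl⟩
      · rfl
      · exact absurd hab (not_lt.2 hab'.le)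
    have hrange : ∀ e : Sym2 (Fin N), ¬ e.IsDiag → ∃ i, φ i = e := by
      intro e
      induction e using Sym2.ind with
      | _ a b =>
        intro h
        rw [Sym2.mk_isDiag_iff] at h
        rcases lt_or_gt_of_ne h with h | h
        · exact ⟨⟨(a, b), h⟩, rfl⟩
        · exact ⟨⟨(b, a), h⟩, Sym2.eq_swap⟩
    let s : E → Set Ω := fun i =>
      if φ i ∈ T then {ω | (G ω).Adj i.1.1 i.1.2} else {ω | (G ω).Adj i.1.1 i.1.2}ᶜ
    have hset : {ω | edgesOf (G ω) = T} = ⋂ i, s i := by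
      ext ω
      simp only [Set.mem_ofPred_eq, Set.mem_iInter]
      constructor
      · rintro rfl i
        by_cases h : (G ω).Adj i.1.1 i.1.2 <;> simp [s, φ, mem_edgesOf, h]
      · intro h
        ext e
        rw [mem_edgesOf]
        by_cases he : e.IsDiag
        · exact iff_of_false (fun h => (G ω).not_isDiag_of_mem_edgeSet h he)
            fun h => hdiag e h he
        · obtain ⟨i, rfl⟩ := hrange e he
          have := h i
          by_cases hT : φ i ∈ T
          · simp only [s, hT, if_true] at this
            exact iff_of_true this hT
          · simp only [s, hT, if_false] at this
            exact iff_of_false this hT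
    have hmeas : ∀ i, MeasurableSet (s i) := by
      intro i
      simp only [s]
      split_ifs
      · exact hG.measurableSet_adj _ _
      · exact (hG.measurableSet_adj _ _).compl
    refine ⟨by rw [hset]; exact MeasurableSet.iInter hmeas, ?_⟩
    have hind := (iIndepSet_iff_iIndep _ _).1 hG.indep
    have hprod := hind.meas_iInter (s := s) fun i => by
      have h0 := MeasurableSpace.measurableSet_generateFrom
        (Set.mem_singleton {ω | (G ω).Adj i.1.1 i.1.2})
      simp only [s]
      split_ifs
      · exact h0
      · exact h0.compl
    rw [hset, measureReal_def, hprod, ENNReal.toReal_prod, bernWeight,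
      ← Finset.prod_subset (Finset.subset_univ (Finset.univ.image φ)),
      Finset.prod_image hφ.injOn]
    · refine Finset.prod_congr rfl fun i _ => ?_
      by_cases hT : φ i ∈ T
      · simp only [s, hT, if_true]
        rfl
      · simp only [s, hT, if_false]
        exact probReal_compl_eq_one_sub (hG.measurableSet_adj _ _)
    · intro e _ he
      have hed : e.IsDiag := by
        by_contra h
        obtain ⟨i, rfl⟩ := hrange e h
        exact he (Finset.mem_image_of_mem φ (Finset.mem_univ i))
      have h1 : ∀ ω, e ∉ (G ω).edgeSet := fun ω h =>
        (G ω).not_isDiag_of_mem_edgeSet h hed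
      rw [if_neg fun h => hdiag e h hed]
      simp [h1]

lemma IsInhomogeneousRandomGraph.measureReal_edgesOf_mem (hG : IsInhomogeneousRandomGraph μ q G)
    (A : Set (Finset (Sym2 (Fin N)))) :
    μ.real {ω | edgesOf (G ω) ∈ A} = bernProb (fun e => μ.real {ω | e ∈ (G ω).edgeSet}) A := by
  classical
  have h1 : {ω | edgesOf (G ω) ∈ A} =
      ⋃ T ∈ Finset.univ.filter (· ∈ A), {ω | edgesOf (G ω) = T} := by
    ext ω
    simp
  rw [h1, measureReal_biUnion_finset]
  · rw [bernProb, bernExp, Finset.sum_filter]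
    refine Finset.sum_congr rfl fun T _ => ?_
    by_cases hT : T ∈ A <;> simp [hT, (hG.measureReal_edgesOf_eq T).2]
  · intro T _ T' _ hne
    exact Set.disjoint_left.2 fun ω h h' => hne (h.symm.trans h')
  · exact fun T _ => (hG.measureReal_edgesOf_eq T).1

/-- The Chung-Lu connection probabilities of unordered pairs; loops have probability `0`. -/
def chungLuSym (β γ : ℝ) (N : ℕ) (e : Sym2 (Fin N)) : ℝ :=
  open Classical in
  if e.IsDiag then 0 else
    Sym2.lift ⟨chungLuProb β γ N, fun i j => by simp only [chungLuProb, mul_comm]⟩ e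

lemma chungLuSym_mk {β γ : ℝ} {i j : Fin N} (hij : i ≠ j) :
    chungLuSym β γ N s(i, j) = chungLuProb β γ N i j := by
  simp [chungLuSym, hij]

/-- The distance of the edge set of a graph in the class `𝒢_{β,γ}` from that of the
Chung-Lu graph. -/
lemma IsInhomogeneousRandomGraph.sq_measureReal_sub_bernProb_le
    (hG : IsInhomogeneousRandomGraph μ q G) {β γ : ℝ}
    (hp : ∀ i j, 0 < chungLuProb β γ N i j ∧ chungLuProb β γ N i j ≤ 1 / 2)
    (A : Set (Finset (Sym2 (Fin N)))) :
    (μ.real {ω | edgesOf (G ω) ∈ A} - bernProb (chungLuSym β γ N) A) ^ 2 ≤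
      Real.exp (2 * ∑ i : Fin N, ∑ j : Fin N,
        if i ≠ j then (chungLuProb β γ N i j - q i j) ^ 2 / chungLuProb β γ N i j else 0) - 1 := by
  classical
  set qe : Sym2 (Fin N) → ℝ := fun e => μ.real {ω | e ∈ (G ω).edgeSet} with hqe
  have hqdiag : ∀ e : Sym2 (Fin N), e.IsDiag → qe e = 0 := by
    intro e he
    have h1 : ∀ ω, e ∉ (G ω).edgeSet := fun ω h =>
      (G ω).not_isDiag_of_mem_edgeSet h he
    simp [hqe, h1]
  have hpdiag : ∀ e : Sym2 (Fin N), e.IsDiag → chungLuSym β γ N e = 0 := fun e he => by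
    simp [chungLuSym, he]
  have hq : ∀ i j, i ≠ j → qe s(i, j) = q i j := fun i j hij => hG.prob_adj i j hij
  rw [hG.measureReal_edgesOf_mem]
  refine (sq_bernProb_sub_le (p := chungLuSym β γ N) ?_ ?_ A).trans ?_
  · intro e
    induction e using Sym2.ind with
    | _ i j =>
      by_cases hij : i = j
      · rw [hpdiag _ (by simpa using hij)]
        norm_num
      · rw [chungLuSym_mk hij]
        exact ⟨(hp i j).1.le, (hp i j).2⟩
  · intro e
    induction e using Sym2.ind with
    | _ i j =>
      by_cases hij : i = j
      · exact fun _ => hqdiag _ (by simpa using hij)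
      · rw [chungLuSym_mk hij]
        exact fun h => absurd h (hp i j).1.ne'
  · gcongr
    let t : Fin N × Fin N → ℝ := fun x => if x.1 ≠ x.2 then
      (chungLuProb β γ N x.1 x.2 - q x.1 x.2) ^ 2 / chungLuProb β γ N x.1 x.2 else 0
    have ht : ∀ x : Fin N × Fin N, (chungLuSym β γ N s(x.1, x.2) - qe s(x.1, x.2)) ^ 2 /
        chungLuSym β γ N s(x.1, x.2) = t x := by
      rintro ⟨i, j⟩
      by_cases h : i = j
      · simp only
        rw [hpdiag s(i, j) (by simpa using h), hqdiag s(i, j) (by simpa using h)]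
        simp [t, h]
      · simp only
        rw [chungLuSym_mk h, hq _ _ h]
        simp [t, h]
    let ψ : Sym2 (Fin N) → Fin N × Fin N := Quot.out
    have hψ : ∀ e, s((ψ e).1, (ψ e).2) = e := fun e => Quot.out_eq e
    have hψi : Function.Injective ψ := fun e e' h => by rw [← hψ e, h, hψ e']
    calc _ = ∑ e : Sym2 (Fin N), t (ψ e) := by
          refine Finset.sum_congr rfl fun e _ => ?_
          have := ht (ψ e)
          rw [hψ] at this
          exact this
      _ = ∑ x ∈ Finset.univ.image ψ, t x := (Finset.sum_image hψi.injOn).symm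
      _ ≤ ∑ x, t x := by
          refine Finset.sum_le_sum_of_subset_of_nonneg (Finset.subset_univ _) fun x _ _ => ?_
          simp only [t]
          split_ifs
          · exact div_nonneg (sq_nonneg _) (hp _ _).1.le
          · exact le_rfl
      _ = _ := Fintype.sum_prod_type _

end EdgeSet

/-! ### Double stars in a random graph with edge probabilities of rank one -/

section RankOne

/-- The edge set `S` contains the path `(v₁, v₂, v₃, v₄)`, and no other edge touches `v₂` or
`v₃`; the other edges neither connect `v₁` to `v₄` nor connect one of them to a cycle; and
the numbers of these edges at `v₁` and `v₄` lie in `(d / 2, 3 d' / 2)`. -/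
structure IsGoodPath {V : Type*} [Fintype V] [DecidableEq V] (d d' : ℝ) (S : Finset (Sym2 V))
    (v₁ v₂ v₃ v₄ : V) : Prop where
  nodup : [v₁, v₂, v₃, v₄].Nodup
  inter : S ∩ pairsTouching v₂ v₃ = pathEdges v₁ v₂ v₃ v₄
  notMem_trailBetween : S \ pairsTouching v₂ v₃ ∉ TrailBetween v₁ v₄
  notMem_lasso₁ : S \ pairsTouching v₂ v₃ ∉ Lasso v₁
  notMem_lasso₄ : S \ pairsTouching v₂ v₃ ∉ Lasso v₄
  card₁ : d / 2 < (S ∩ starPairs v₁ v₂ v₃).card ∧ ((S ∩ starPairs v₁ v₂ v₃).card : ℝ) < 3 * d' / 2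
  card₄ : d / 2 < (S ∩ starPairs v₄ v₃ v₂).card ∧ ((S ∩ starPairs v₄ v₃ v₂).card : ℝ) < 3 * d' / 2

lemma cylinderProb_ge {ι : Type*} [DecidableEq ι] {p : ι → ℝ} (hp : ∀ i, 0 ≤ p i ∧ p i ≤ 1 / 2)
    {F D : Finset ι} (hD : D ⊆ F) :
    (∏ i ∈ D, p i) * Real.exp (-(2 * ∑ i ∈ F, p i)) ≤ cylinderProb p F D := by
  have h1 : cylinderProb p F D = (∏ i ∈ D, p i) * ∏ i ∈ F \ D, (1 - p i) := by
    rw [cylinderProb, ← Finset.prod_sdiff hD, mul_comm]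
    congr 1
    · exact Finset.prod_congr rfl fun i hi => if_pos hi
    · exact Finset.prod_congr rfl fun i hi => if_neg (Finset.mem_sdiff.1 hi).2
  rw [h1]
  refine mul_le_mul_of_nonneg_left ?_ (Finset.prod_nonneg fun i _ => (hp i).1)
  calc Real.exp (-(2 * ∑ i ∈ F, p i)) ≤ Real.exp (-(2 * ∑ i ∈ F \ D, p i)) := by
        gcongr
        · exact fun i _ _ => (hp i).1
        · exact Finset.sdiff_subset
    _ = ∏ i ∈ F \ D, Real.exp (-(2 * p i)) := by
        rw [Finset.mul_sum, ← Finset.sum_neg_distrib, Real.exp_sum]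
    _ ≤ _ := Finset.prod_le_prod (fun i _ => (Real.exp_pos _).le) fun i _ => by
        have h2 := (hp i).1
        have h3 := (hp i).2
        rw [Real.exp_neg]
        refine inv_le_of_inv_le₀ (by linarith) ?_
        refine le_trans ?_ (Real.add_one_le_exp _)
        rw [inv_le_iff_one_le_mul₀ (by linarith)]
        nlinarith

variable {V : Type*} [Fintype V] [DecidableEq V]

lemma disjoint_starPairs_pairsTouching {v a b : V} (ha : v ≠ a) (hb : v ≠ b) :
    Disjoint (starPairs v a b) (pairsTouching a b) := by
  rw [Finset.disjoint_left]
  intro e he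
  simp only [starPairs, Finset.mem_image, Finset.mem_sdiff, Finset.mem_univ, true_and,
    Finset.mem_insert, Finset.mem_singleton, not_or] at he
  obtain ⟨w, ⟨h1, h2, h3⟩, rfl⟩ := he
  simp only [pairsTouching, Finset.mem_filter, Finset.mem_univ, true_and, Sym2.mem_iff]
  grind

lemma pairsTouching_comm (a b : V) : pairsTouching a b = pairsTouching b a := by
  ext e
  simp only [pairsTouching, Finset.mem_filter, or_comm]

lemma sum_pairsTouching_le {p : Sym2 V → ℝ} (hp : ∀ e, 0 ≤ p e) (a b : V) :
    ∑ e ∈ pairsTouching a b, p e ≤ ∑ w, p s(a, w) + ∑ w, p s(b, w) := by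
  have h1 : pairsTouching a b ⊆
      (Finset.univ.image fun w => s(a, w)) ∪ Finset.univ.image fun w => s(b, w) := by
    intro e he
    simp only [pairsTouching, Finset.mem_filter, Finset.mem_univ, true_and] at he
    simp only [Finset.mem_union, Finset.mem_image, Finset.mem_univ, true_and]
    rcases he with ⟨w, rfl⟩ | ⟨w, rfl⟩
    · exact Or.inl ⟨w, rfl⟩
    · exact Or.inr ⟨w, rfl⟩
  have h2 : ∀ v : V, ∑ e ∈ Finset.univ.image (fun w => s(v, w)), p e = ∑ w, p s(v, w) :=
    fun v => Finset.sum_image fun _ _ _ _ h => Sym2.congr_right.1 h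
  rw [← h2 a, ← h2 b, ← Finset.sum_union_inter]
  have h3 : 0 ≤ ∑ e ∈ (Finset.univ.image fun w => s(a, w)) ∩
      Finset.univ.image fun w => s(b, w), p e := Finset.sum_nonneg fun e _ => hp e
  have h4 := Finset.sum_le_sum_of_subset_of_nonneg h1 (f := p) fun e _ _ => hp e
  linarith

/-- Two different paths between the same sets of ends and of centres occur together only if they
have no common centre, and then at most four pairs touch a centre of both of them. -/
lemma bernProb_path_inter_le {p : Sym2 V → ℝ} {c : ℝ} (hp : ∀ e, 0 ≤ p e ∧ p e ≤ c)
    (hc0 : 0 ≤ c) (hc : c ≤ 1 / 8) {v₁ v₂ v₃ v₄ w₁ w₂ w₃ w₄ : V}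
    (hv : [v₁, v₂, v₃, v₄].Nodup) (hw : [w₁, w₂, w₃, w₄].Nodup)
    (hvw : v₁ ≠ w₂ ∧ v₁ ≠ w₃ ∧ v₄ ≠ w₂ ∧ v₄ ≠ w₃ ∧ w₁ ≠ v₂ ∧ w₁ ≠ v₃ ∧ w₄ ≠ v₂ ∧ w₄ ≠ v₃ ∧
      v₂ ≠ w₃ ∧ v₃ ≠ w₂)
    (hne : (v₁, v₂, v₃, v₄) ≠ (w₁, w₂, w₃, w₄)) :
    bernProb p ({S | S ∩ pairsTouching v₂ v₃ = pathEdges v₁ v₂ v₃ v₄} ∩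
        {S | S ∩ pairsTouching w₂ w₃ = pathEdges w₁ w₂ w₃ w₄}) ≤
      (1 + 8 * c) * (cylinderProb p (pairsTouching v₂ v₃) (pathEdges v₁ v₂ v₃ v₄) *
        cylinderProb p (pairsTouching w₂ w₃) (pathEdges w₁ w₂ w₃ w₄)) := by
  obtain ⟨h12, h13, h42, h43, k12, k13, k42, k43, h23, h32⟩ := hvw
  have hp' : ∀ i, 0 ≤ p i ∧ p i ≤ 1 := fun i => ⟨(hp i).1, by linarith [(hp i).2]⟩
  by_cases hcentre : v₂ = w₂ ∨ v₃ = w₃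
  · have hempty : ({S | S ∩ pairsTouching v₂ v₃ = pathEdges v₁ v₂ v₃ v₄} ∩
        {S | S ∩ pairsTouching w₂ w₃ = pathEdges w₁ w₂ w₃ w₄} : Set (Finset (Sym2 V))) = ∅ := by
      rw [Set.eq_empty_iff_forall_notMem]
      rintro S ⟨hS, hS'⟩
      obtain ⟨a2, a3⟩ := adj_of_inter_pairsTouching hv hS
      obtain ⟨b2, b3⟩ := adj_of_inter_pairsTouching hw hS'
      apply hne
      have key : ∀ {z}, v₂ = z → w₂ = z → v₁ = w₁ ∧ v₃ = w₃ := by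
        rintro z rfl h
        rw [h] at b2
        have h1 := (b2 v₁).1 ((a2 v₁).2 (Or.inl rfl))
        have h3 := (b2 v₃).1 ((a2 v₃).2 (Or.inr rfl))
        exact ⟨h1.resolve_right h13, h3.resolve_left fun h => k13 h.symm⟩
      have key' : ∀ {z}, v₃ = z → w₃ = z → v₂ = w₂ ∧ v₄ = w₄ := by
        rintro z rfl h
        rw [h] at b3
        have h1 := (b3 v₂).1 ((a3 v₂).2 (Or.inl rfl))
        have h3 := (b3 v₄).1 ((a3 v₄).2 (Or.inr rfl))
        exact ⟨h1.resolve_right fun h => k42 h.symm, h3.resolve_left h42⟩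
      rcases hcentre with h | h
      · obtain ⟨e1, e3⟩ := key h rfl
        obtain ⟨-, e4⟩ := key' e3 rfl
        rw [e1, h, e3, e4]
      · obtain ⟨e2, e4⟩ := key' h rfl
        obtain ⟨e1, -⟩ := key e2 rfl
        rw [e1, h, e2, e4]
    rw [hempty]
    have h0 : bernProb p ∅ = 0 := by
      rw [← bernExp_const p 0, bernProb, Set.indicator_empty]
    rw [h0]
    exact mul_nonneg (by linarith)
      (mul_nonneg (cylinderProb_nonneg hp' _ _) (cylinderProb_nonneg hp' _ _))
  · push Not at hcentre
    obtain ⟨n22, n33⟩ := hcentre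
    refine bernProb_cylinder_inter_le hp hc0 hc (pathEdges_subset_pairsTouching _ _ _ _)
      (pathEdges_subset_pairsTouching _ _ _ _) ?_ ?_ ?_
    · rw [Finset.disjoint_left]
      intro e he
      simp only [pathEdges, Finset.mem_insert, Finset.mem_singleton] at he
      rcases he with rfl | rfl | rfl <;>
        simp only [pairsTouching, Finset.mem_filter, Finset.mem_univ, true_and, Sym2.mem_iff] <;>
        grind
    · rw [Finset.disjoint_left]
      intro e he
      simp only [pathEdges, Finset.mem_insert, Finset.mem_singleton] at he
      rcases he with rfl | rfl | rfl <;>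
        simp only [pairsTouching, Finset.mem_filter, Finset.mem_univ, true_and, Sym2.mem_iff] <;>
        grind
    · have hsub : pairsTouching v₂ v₃ ∩ pairsTouching w₂ w₃ ⊆
          {s(v₂, w₂), s(v₂, w₃), s(v₃, w₂), s(v₃, w₃)} := by
        intro e he
        induction e using Sym2.ind with
        | _ a b =>
          simp only [pairsTouching, Finset.mem_inter, Finset.mem_filter, Finset.mem_univ,
            true_and, Sym2.mem_iff] at he
          simp only [Finset.mem_insert, Finset.mem_singleton, Sym2.eq_iff]
          grind
      exact (Finset.card_le_card hsub).trans Finset.card_le_four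

/-- For edge probabilities `c x_u x_v`, a good path with ends in `A₁` and `A₂` and centres in `B₁`
and `B₂` exists with high probability if the expected number of candidates is large. -/
lemma bernProb_not_exists_isGoodPath_le {p : Sym2 V → ℝ} {c r a b M d d' : ℝ} {x : V → ℝ}
    (hc0 : 0 < c) (hc : c ≤ 1 / 8) (hx : ∀ v, 0 < x v ∧ x v ≤ 1) (hp0 : ∀ e, 0 ≤ p e)
    (hpx : ∀ u v, p s(u, v) ≤ c * x u * x v)
    (hpx' : ∀ u v, u ≠ v → p s(u, v) = c * x u * x v)
    (hr : c * ∑ v, x v ^ 2 ≤ r) (hr1 : r < 1) {A₁ A₂ B₁ B₂ : Finset V}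
    (hA : Disjoint A₁ A₂) (hB : Disjoint B₁ B₂) (hAB : Disjoint (A₁ ∪ A₂) (B₁ ∪ B₂))
    (ha0 : 0 < a) (ha : ∀ v ∈ A₁ ∪ A₂, a ≤ x v) (hb0 : 0 < b) (hb : ∀ v ∈ B₁ ∪ B₂, b ≤ x v)
    (hM : ∀ v ∈ B₁ ∪ B₂, c * x v * ∑ w, x w ≤ M)
    (hd0 : 0 < d) (hd : ∀ v ∈ A₁ ∪ A₂, ∀ w₁ w₂, d ≤ ∑ e ∈ starPairs v w₁ w₂, p e)
    (hd' : ∀ v ∈ A₁ ∪ A₂, c * x v * ∑ w, x w ≤ d') {m : ℝ} (hm : 0 < m)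
    (hm' : m ≤ (A₁.card * B₁.card * B₂.card * A₂.card) *
      (c ^ 3 * a ^ 2 * b ^ 4 * Real.exp (-(4 * M)))) :
    bernProb p {S | ¬ ∃ v₁ ∈ A₁, ∃ v₂, ∃ v₃, ∃ v₄ ∈ A₂, IsGoodPath d d' S v₁ v₂ v₃ v₄} ≤
      4 / m + 4 * (8 * c) +
        2 * (c / (1 - r) + 2 * c / (1 - r) ^ 2 + 2 * c / (1 - r) ^ 2 + 4 / d + 4 / d) := by
  have hx0 : ∀ v, 0 ≤ x v := fun v => (hx v).1.le
  have h1r : 0 < 1 - r := by linarith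
  have hpc : ∀ e, 0 ≤ p e ∧ p e ≤ c := by
    intro e
    refine ⟨hp0 e, ?_⟩
    induction e using Sym2.ind with
    | _ u v =>
      refine (hpx u v).trans ?_
      exact mul_le_of_le_one_right (mul_nonneg hc0.le (hx0 u)) (hx v).2 |>.trans
        (mul_le_of_le_one_right hc0.le (hx u).2)
  have hp1 : ∀ e, 0 ≤ p e ∧ p e ≤ 1 := fun e => ⟨hp0 e, by linarith [(hpc e).2]⟩
  have hp2 : ∀ e, 0 ≤ p e ∧ p e ≤ 1 / 2 := fun e => ⟨hp0 e, by linarith [(hpc e).2]⟩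
  let 𝒜 : Finset (V × V × V × V) := A₁ ×ˢ B₁ ×ˢ B₂ ×ˢ A₂
  have h𝒜 : ∀ v₁ v₂ v₃ v₄, (v₁, v₂, v₃, v₄) ∈ 𝒜 ↔ v₁ ∈ A₁ ∧ v₂ ∈ B₁ ∧ v₃ ∈ B₂ ∧ v₄ ∈ A₂ := by
    simp [𝒜]
  have neA : ∀ {u v}, u ∈ A₁ → v ∈ A₂ → u ≠ v := fun hu hv h =>
    Finset.disjoint_left.1 hA hu (h ▸ hv)
  have neB : ∀ {u v}, u ∈ B₁ → v ∈ B₂ → u ≠ v := fun hu hv h =>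
    Finset.disjoint_left.1 hB hu (h ▸ hv)
  have neAB : ∀ {u v}, u ∈ A₁ ∪ A₂ → v ∈ B₁ ∪ B₂ → u ≠ v := fun hu hv h =>
    Finset.disjoint_left.1 hAB hu (h ▸ hv)
  have hA1 : ∀ {u}, u ∈ A₁ → u ∈ A₁ ∪ A₂ := fun h => Finset.mem_union_left _ h
  have hA2 : ∀ {u}, u ∈ A₂ → u ∈ A₁ ∪ A₂ := fun h => Finset.mem_union_right _ h
  have hB1 : ∀ {u}, u ∈ B₁ → u ∈ B₁ ∪ B₂ := fun h => Finset.mem_union_left _ h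
  have hB2 : ∀ {u}, u ∈ B₂ → u ∈ B₁ ∪ B₂ := fun h => Finset.mem_union_right _ h
  have hnodup : ∀ {v₁ v₂ v₃ v₄}, (v₁, v₂, v₃, v₄) ∈ 𝒜 → [v₁, v₂, v₃, v₄].Nodup := by
    intro v₁ v₂ v₃ v₄ h
    obtain ⟨m1, m2, m3, m4⟩ := (h𝒜 _ _ _ _).1 h
    simp only [List.nodup_cons, List.mem_cons, List.not_mem_nil, or_false, not_or,
      not_false_eq_true, List.nodup_nil, and_true]
    exact ⟨⟨neAB (hA1 m1) (hB1 m2), neAB (hA1 m1) (hB2 m3), neA m1 m4⟩,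
      ⟨neB m2 m3, (neAB (hA2 m4) (hB1 m2)).symm⟩, (neAB (hA2 m4) (hB2 m3)).symm⟩
  let F : V × V × V × V → Finset (Sym2 V) := fun α => pairsTouching α.2.1 α.2.2.1
  let D : V × V × V × V → Finset (Sym2 V) := fun α => pathEdges α.1 α.2.1 α.2.2.1 α.2.2.2
  let dev : V → V → V → Set (Finset (Sym2 V)) := fun v w₁ w₂ =>
    {S | (∑ e ∈ starPairs v w₁ w₂, p e) / 2 ≤
      |((S ∩ starPairs v w₁ w₂).card : ℝ) - ∑ e ∈ starPairs v w₁ w₂, p e|}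
  let bad : V × V × V × V → Set (Finset (Sym2 V)) := fun α =>
    TrailBetween α.1 α.2.2.2 ∪ Lasso α.1 ∪ Lasso α.2.2.2 ∪
      dev α.1 α.2.1 α.2.2.1 ∪ dev α.2.2.2 α.2.2.1 α.2.1
  have hstar1 : ∀ {v₁ v₂ v₃ v₄}, (v₁, v₂, v₃, v₄) ∈ 𝒜 → ∀ S : Finset (Sym2 V),
      (S \ pairsTouching v₂ v₃) ∩ starPairs v₁ v₂ v₃ = S ∩ starPairs v₁ v₂ v₃ := by
    intro v₁ v₂ v₃ v₄ h S
    obtain ⟨m1, m2, m3, m4⟩ := (h𝒜 _ _ _ _).1 h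
    have := disjoint_starPairs_pairsTouching (neAB (hA1 m1) (hB1 m2)) (neAB (hA1 m1) (hB2 m3))
    rw [Finset.inter_comm, ← Finset.inter_sdiff_assoc, Finset.inter_comm,
      Finset.sdiff_eq_self_of_disjoint (this.mono_left Finset.inter_subset_right)]
  have hstar4 : ∀ {v₁ v₂ v₃ v₄}, (v₁, v₂, v₃, v₄) ∈ 𝒜 → ∀ S : Finset (Sym2 V),
      (S \ pairsTouching v₂ v₃) ∩ starPairs v₄ v₃ v₂ = S ∩ starPairs v₄ v₃ v₂ := by
    intro v₁ v₂ v₃ v₄ h S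
    obtain ⟨m1, m2, m3, m4⟩ := (h𝒜 _ _ _ _).1 h
    have := disjoint_starPairs_pairsTouching (neAB (hA2 m4) (hB2 m3)) (neAB (hA2 m4) (hB1 m2))
    rw [pairsTouching_comm, Finset.inter_comm, ← Finset.inter_sdiff_assoc, Finset.inter_comm,
      Finset.sdiff_eq_self_of_disjoint (this.mono_left Finset.inter_subset_right)]
  have hdev : ∀ v ∈ A₁ ∪ A₂, ∀ w₁ w₂, bernProb p (dev v w₁ w₂) ≤ 4 / d := fun v hv w₁ w₂ =>
    (bernProb_card_deviation_le hp1 _ (hd0.trans_le (hd v hv w₁ w₂))).trans (by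
      gcongr
      exact hd v hv w₁ w₂)
  have hbad : ∀ α ∈ 𝒜, bernProb p {S | S \ F α ∈ bad α} ≤
      c / (1 - r) + 2 * c / (1 - r) ^ 2 + 2 * c / (1 - r) ^ 2 + 4 / d + 4 / d := by
    rintro ⟨v₁, v₂, v₃, v₄⟩ hα
    obtain ⟨m1, m2, m3, m4⟩ := (h𝒜 _ _ _ _).1 hα
    have hsub : ({S | S \ F (v₁, v₂, v₃, v₄) ∈ bad (v₁, v₂, v₃, v₄)} : Set (Finset (Sym2 V))) ⊆
        TrailBetween v₁ v₄ ∪ Lasso v₁ ∪ Lasso v₄ ∪ dev v₁ v₂ v₃ ∪ dev v₄ v₃ v₂ := by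
      rintro S ((((h | h) | h) | h) | h)
      · exact Or.inl (Or.inl (Or.inl (Or.inl
          (isUpperSet_trailBetween _ _ Finset.sdiff_subset h))))
      · exact Or.inl (Or.inl (Or.inl (Or.inr (isUpperSet_lasso _ Finset.sdiff_subset h))))
      · exact Or.inl (Or.inl (Or.inr (isUpperSet_lasso _ Finset.sdiff_subset h)))
      · refine Or.inl (Or.inr ?_)
        simp only [dev, F, Set.mem_ofPred_eq, hstar1 hα] at h ⊢
        exact h
      · refine Or.inr ?_
        simp only [dev, F, Set.mem_ofPred_eq, hstar4 hα] at h ⊢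
        exact h
    refine (bernProb_mono hp1 hsub).trans ((bernProb_union_le hp1 _ _).trans
      (add_le_add ((bernProb_union_le hp1 _ _).trans (add_le_add ((bernProb_union_le hp1 _ _).trans
        (add_le_add ((bernProb_union_le hp1 _ _).trans (add_le_add ?_ ?_)) ?_)) ?_)) ?_))
    · refine (bernProb_trailBetween_le hp1 hc0.le hx0 hpx hr hr1 v₁ v₄).trans ?_
      gcongr
      exact (mul_le_of_le_one_right (mul_nonneg hc0.le (hx0 v₁)) (hx v₄).2).trans
        (mul_le_of_le_one_right hc0.le (hx v₁).2)
    · exact bernProb_lasso_le hp1 hc0.le (fun v => ⟨hx0 v, (hx v).2⟩) hpx hr hr1 v₁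
    · exact bernProb_lasso_le hp1 hc0.le (fun v => ⟨hx0 v, (hx v).2⟩) hpx hr hr1 v₄
    · exact hdev v₁ (hA1 m1) _ _
    · exact hdev v₄ (hA2 m4) _ _
  have hmean : m ≤ ∑ α ∈ 𝒜, cylinderProb p (F α) (D α) := by
    have hterm : ∀ α ∈ 𝒜, c ^ 3 * a ^ 2 * b ^ 4 * Real.exp (-(4 * M)) ≤
        cylinderProb p (F α) (D α) := by
      rintro ⟨v₁, v₂, v₃, v₄⟩ hα
      -- The exclusion of all other pairs at `v₂` and `v₃` costs only a constant factor, because the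
      -- expected degrees of `v₂` and `v₃` are at most `M`.
      have hnd := hnodup hα
      obtain ⟨m1, m2, m3, m4⟩ := (h𝒜 _ _ _ _).1 hα
      simp only [List.nodup_cons, List.mem_cons, List.not_mem_nil, or_false, not_or,
        not_false_eq_true, List.nodup_nil, and_true] at hnd
      obtain ⟨⟨n12, n13, n14⟩, ⟨n23, n24⟩, n34⟩ := hnd
      refine le_trans ?_ (cylinderProb_ge hp2 (pathEdges_subset_pairsTouching _ _ _ _))
      have hprod : ∏ e ∈ pathEdges v₁ v₂ v₃ v₄, p e =
          (c * x v₁ * x v₂) * ((c * x v₂ * x v₃) * (c * x v₃ * x v₄)) := by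
        rw [pathEdges, Finset.prod_insert, Finset.prod_insert, Finset.prod_singleton,
          hpx' _ _ n12, hpx' _ _ n23, hpx' _ _ n34]
        · simp only [Finset.mem_singleton, Sym2.eq_iff]
          grind
        · simp only [Finset.mem_insert, Finset.mem_singleton, Sym2.eq_iff]
          grind
      have hsumF : ∑ e ∈ pairsTouching v₂ v₃, p e ≤ M + M := by
        refine (sum_pairsTouching_le hp0 v₂ v₃).trans (add_le_add ?_ ?_)
        · refine le_trans ?_ (hM v₂ (hB1 m2))
          rw [Finset.mul_sum]
          exact Finset.sum_le_sum fun w _ => hpx _ _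
        · refine le_trans ?_ (hM v₃ (hB2 m3))
          rw [Finset.mul_sum]
          exact Finset.sum_le_sum fun w _ => hpx _ _
      have e1 := ha v₁ (hA1 m1)
      have e2 := hb v₂ (hB1 m2)
      have e3 := hb v₃ (hB2 m3)
      have e4 := ha v₄ (hA2 m4)
      calc c ^ 3 * a ^ 2 * b ^ 4 * Real.exp (-(4 * M))
          = ((c * a * b) * ((c * b * b) * (c * b * a))) * Real.exp (-(4 * M)) := by ring
        _ ≤ (∏ e ∈ pathEdges v₁ v₂ v₃ v₄, p e) *
            Real.exp (-(2 * ∑ e ∈ pairsTouching v₂ v₃, p e)) := by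
            rw [hprod]
            have := hx0 v₁
            have := hx0 v₂
            have := hx0 v₃
            have := hx0 v₄
            exact mul_le_mul (by gcongr) (Real.exp_le_exp.2 (by linarith)) (Real.exp_pos _).le
              (by positivity)
    calc m ≤ _ := hm'
      _ = ∑ _α ∈ 𝒜, c ^ 3 * a ^ 2 * b ^ 4 * Real.exp (-(4 * M)) := by
          rw [Finset.sum_const, nsmul_eq_mul]
          simp only [𝒜, Finset.card_product]
          push_cast
          ring
      _ ≤ _ := Finset.sum_le_sum hterm
  have hstarle : ∀ v w₁ w₂, ∑ e ∈ starPairs v w₁ w₂, p e ≤ c * x v * ∑ w, x w := by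
    intro v w₁ w₂
    rw [starPairs, Finset.sum_image fun _ _ _ _ h => Sym2.congr_right.1 h, Finset.mul_sum]
    refine (Finset.sum_le_sum fun w _ => hpx v w).trans ?_
    exact Finset.sum_le_sum_of_subset_of_nonneg (Finset.subset_univ _) fun w _ _ =>
      mul_nonneg (mul_nonneg hc0.le (hx0 v)) (hx0 w)
  have hcard : ∀ {v w₁ w₂} {S : Finset (Sym2 V)}, v ∈ A₁ ∪ A₂ → S ∉ dev v w₁ w₂ →
      d / 2 < (S ∩ starPairs v w₁ w₂).card ∧
        ((S ∩ starPairs v w₁ w₂).card : ℝ) < 3 * d' / 2 := by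
    intro v w₁ w₂ S hv h
    have h1 := hd v hv w₁ w₂
    have h2 := (hstarle v w₁ w₂).trans (hd' v hv)
    simp only [dev, Set.mem_ofPred_eq, not_le] at h
    have h3 := abs_lt.1 h
    constructor <;> linarith [h3.1, h3.2]
  have hsub : ({S | ¬ ∃ v₁ ∈ A₁, ∃ v₂, ∃ v₃, ∃ v₄ ∈ A₂, IsGoodPath d d' S v₁ v₂ v₃ v₄} :
      Set (Finset (Sym2 V))) ⊆ {S | ∀ α ∈ 𝒜, S ∩ F α = D α → S \ F α ∈ bad α} := by
    rintro S hS ⟨v₁, v₂, v₃, v₄⟩ hα hSα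
    by_contra hcon
    obtain ⟨m1, m2, m3, m4⟩ := (h𝒜 _ _ _ _).1 hα
    simp only [bad, F, Set.mem_union, not_or] at hcon
    obtain ⟨⟨⟨⟨c1, c2⟩, c3⟩, c4⟩, c5⟩ := hcon
    have c4' := hcard (hA1 m1) c4
    have c5' := hcard (hA2 m4) c5
    rw [hstar1 hα] at c4'
    rw [hstar4 hα] at c5'
    exact hS ⟨v₁, m1, v₂, v₃, v₄, m4, hnodup hα, hSα, c1, c2, c3, c4', c5'⟩
  refine (bernProb_mono hp1 hsub).trans ((bernProb_forall_bad_le hp1 𝒜 F D ?_ bad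
    (δ := 8 * c) (by positivity) hbad ?_ (hm.trans_le hmean)).trans ?_)
  · exact fun α _ => pathEdges_subset_pairsTouching _ _ _ _
  · rintro ⟨v₁, v₂, v₃, v₄⟩ hα ⟨w₁, w₂, w₃, w₄⟩ hα' hne
    obtain ⟨m1, m2, m3, m4⟩ := (h𝒜 _ _ _ _).1 hα
    obtain ⟨k1, k2, k3, k4⟩ := (h𝒜 _ _ _ _).1 hα'
    exact bernProb_path_inter_le hpc hc0.le hc (hnodup hα) (hnodup hα')
      ⟨neAB (hA1 m1) (hB1 k2), neAB (hA1 m1) (hB2 k3), neAB (hA2 m4) (hB1 k2),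
        neAB (hA2 m4) (hB2 k3), neAB (hA1 k1) (hB1 m2), neAB (hA1 k1) (hB2 m3),
        neAB (hA2 k4) (hB1 m2), neAB (hA2 k4) (hB2 m3), neB m2 k3, (neB k2 m3).symm⟩ hne
  · gcongr

/-- A good path is a long double star. -/
lemma IsGoodPath.isLongDoubleStar {γ C : ℝ} {N : ℕ} {d d' : ℝ} {G : SimpleGraph (Fin N)}
    {v₁ v₂ v₃ v₄ : Fin N} (h : IsGoodPath d d' (edgesOf G) v₁ v₂ v₃ v₄)
    (hv₁ : ((v₁ : ℕ) : ℝ) + 1 ≤ bigThreshold γ N) (hv₄ : ((v₄ : ℕ) : ℝ) + 1 ≤ bigThreshold γ N)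
    (hdeg : ∀ t : ℝ, d / 2 < t → t < 3 * d' / 2 →
      AgreeUpToLog C N (t + 1) ((N : ℝ) ^ (γ / (2 - 2 * γ)))) :
    IsLongDoubleStar γ C G v₁ v₂ v₃ v₄ := by
  obtain ⟨hv2, hv3⟩ := adj_of_inter_pairsTouching h.nodup h.inter
  have hnd := h.nodup
  simp only [List.nodup_cons, List.mem_cons, List.not_mem_nil, or_false, not_or,
    not_false_eq_true, List.nodup_nil, and_true] at hnd
  obtain ⟨⟨n12, n13, n14⟩, ⟨n23, n24⟩, n34⟩ := hnd
  have htree : ∀ G', G' = SimpleGraph.fromEdgeSet (edgesOf G : Set (Sym2 (Fin N))) →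
      (G'.induce (G'.connectedComponentMk v₁).supp).IsTree := by
    rintro _ rfl
    exact isTree_of_forall_notMem_lasso h.nodup h.inter h.notMem_trailBetween
      h.notMem_lasso₁ h.notMem_lasso₄
  have hd1 := vertexDegree_endpoint (S := edgesOf G) (v := v₁) (a := v₂) (b := v₃) n12
    (by rw [Sym2.eq_swap]; exact (hv2 v₁).2 (Or.inl rfl))
    (by rw [Sym2.eq_swap, hv3]; tauto)
  have hd4 := vertexDegree_endpoint (S := edgesOf G) (v := v₄) (a := v₃) (b := v₂) (Ne.symm n34)
    (by rw [Sym2.eq_swap]; exact (hv3 v₄).2 (Or.inr rfl))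
    (by rw [Sym2.eq_swap, hv2]; grind)
  simp only [fromEdgeSet_edgesOf] at hd1 hd4
  have hadj : ∀ a b, s(a, b) ∈ edgesOf G ↔ G.Adj a b := fun a b => mem_edgesOf G _
  simp only [hadj] at hv2 hv3
  refine ⟨h.nodup, ((hv2 v₁).2 (Or.inl rfl)).symm, (hv2 v₃).2 (Or.inr rfl),
    (hv3 v₄).2 (Or.inr rfl), ?_, ?_, hv₁, hv₄,
    htree G (fromEdgeSet_edgesOf G).symm, ?_, ?_⟩
  · rw [vertexDegree, show G.neighborSet v₂ = {v₁, v₃} by ext b; simp [hv2], Set.ncard_pair n13]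
  · rw [vertexDegree, show G.neighborSet v₃ = {v₂, v₄} by ext b; simp [hv3], Set.ncard_pair n24]
  · rw [hd1]
    push_cast
    exact hdeg _ h.card₁.1 h.card₁.2
  · rw [hd4]
    push_cast
    exact hdeg _ h.card₄.1 h.card₄.2

end RankOne

/-! ### Asymptotics of the Chung-Lu graph -/

section ChungLu

lemma sum_rpow_neg_le {s : ℝ} (hs0 : 0 < s) (hs1 : s < 1) (N : ℕ) :
    ∑ i : Fin N, (((i : ℕ) : ℝ) + 1) ^ (-s) ≤ (N : ℝ) ^ (1 - s) / (1 - s) := by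
  rw [Fin.sum_univ_eq_sum_range (fun i => ((i : ℝ) + 1) ^ (-s))]
  induction N with
  | zero => simp [Real.zero_rpow (by linarith : 1 - s ≠ 0)]
  | succ n ih =>
    rw [Finset.sum_range_succ]
    push_cast
    have hn : (0 : ℝ) < (n : ℝ) + 1 := by positivity
    -- Bernoulli's inequality for `(n / (n + 1)) ^ (1 - s)`.
    have hB := rpow_one_add_le_one_add_mul_self (s := -1 / ((n : ℝ) + 1)) (p := 1 - s)
      (by rw [le_div_iff₀ hn]; linarith [(Nat.cast_nonneg n : (0 : ℝ) ≤ n)]) (by linarith)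
      (by linarith)
    have h1 : (1 : ℝ) + -1 / ((n : ℝ) + 1) = n / ((n : ℝ) + 1) := by
      field_simp
      ring
    rw [h1, Real.div_rpow (Nat.cast_nonneg n) hn.le, div_le_iff₀ (by positivity)] at hB
    have h2 : ((n : ℝ) + 1) ^ (1 - s) = ((n : ℝ) + 1) * ((n : ℝ) + 1) ^ (-s) := by
      rw [sub_eq_add_neg, Real.rpow_add hn, Real.rpow_one]
    have h3 : (n : ℝ) ^ (1 - s) ≤ ((n : ℝ) + 1) ^ (1 - s) - (1 - s) * ((n : ℝ) + 1) ^ (-s) := by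
      have h4 : (1 + (1 - s) * (-1 / ((n : ℝ) + 1))) * ((n : ℝ) + 1) ^ (1 - s) =
          ((n : ℝ) + 1) ^ (1 - s) - (1 - s) * ((n : ℝ) + 1) ^ (-s) := by
        rw [h2]
        field_simp
        ring
      linarith
    refine (add_le_add_left ih _).trans ?_
    have h5 : 0 < 1 - s := by linarith
    rw [div_add' _ _ _ h5.ne']
    gcongr
    linarith

/-- The vertices whose label lies in `(s, t]`. -/
def labelsIoc (N : ℕ) (s t : ℝ) : Finset (Fin N) :=
  open Classical in
  Finset.univ.filter fun i => s < ((i : ℕ) : ℝ) + 1 ∧ ((i : ℕ) : ℝ) + 1 ≤ t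

lemma mem_labelsIoc {N : ℕ} {s t : ℝ} {i : Fin N} :
    i ∈ labelsIoc N s t ↔ s < ((i : ℕ) : ℝ) + 1 ∧ ((i : ℕ) : ℝ) + 1 ≤ t := by
  simp [labelsIoc]

lemma le_card_labelsIoc {N : ℕ} {s t : ℝ} (hs : 0 ≤ s) (hst : s ≤ t) (ht : t ≤ N) :
    t - s - 1 ≤ (labelsIoc N s t).card := by
  have hsub : Finset.Ioc ⌊s⌋₊ ⌊t⌋₊ ⊆ (labelsIoc N s t).image fun i : Fin N => (i : ℕ) + 1 := by
    intro k hk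
    rw [Finset.mem_Ioc] at hk
    have hk1 : s < k := (Nat.floor_lt hs).1 hk.1
    have hk2 : (k : ℝ) ≤ t := (Nat.le_floor_iff (hs.trans hst)).1 hk.2
    have hkN : k ≤ N := by exact_mod_cast hk2.trans ht
    have hk0 : 0 < k := by omega
    have hcast : ((k - 1 : ℕ) : ℝ) + 1 = k := by
      rw [Nat.cast_sub hk0]
      simp
    refine Finset.mem_image.2 ⟨⟨k - 1, by omega⟩, ?_, by simp; omega⟩
    rw [mem_labelsIoc]
    simp only [hcast]
    exact ⟨hk1, hk2⟩
  have h1 := (Finset.card_le_card hsub).trans Finset.card_image_le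
  rw [Nat.card_Ioc] at h1
  have h2 : ⌊t⌋₊ ≤ (labelsIoc N s t).card + ⌊s⌋₊ := by omega
  have h3 : (⌊t⌋₊ : ℝ) ≤ (labelsIoc N s t).card + ⌊s⌋₊ := by exact_mod_cast h2
  have h4 := Nat.lt_floor_add_one t
  have h5 := Nat.floor_le hs
  linarith

lemma chungLuProb_eq {β γ : ℝ} (hβ : 0 < β) (hγ : 0 < γ) {N : ℕ}
    (hc : β * (N : ℝ) ^ (2 * γ - 1) ≤ 1 / 8) (i j : Fin N) :
    chungLuProb β γ N i j = β * (N : ℝ) ^ (2 * γ - 1) * (((i : ℕ) : ℝ) + 1) ^ (-γ) *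
      (((j : ℕ) : ℝ) + 1) ^ (-γ) := by
  have hx : ∀ i : Fin N, 0 < (((i : ℕ) : ℝ) + 1) ^ (-γ) ∧ (((i : ℕ) : ℝ) + 1) ^ (-γ) ≤ 1 :=
    fun i => ⟨by positivity, Real.rpow_le_one_of_one_le_of_nonpos
      (by linarith [(Nat.cast_nonneg (i : ℕ) : (0 : ℝ) ≤ (i : ℕ))]) (by linarith)⟩
  have hc0 : 0 ≤ β * (N : ℝ) ^ (2 * γ - 1) := by positivity
  have h1 : β * (N : ℝ) ^ (2 * γ - 1) / ((((i : ℕ) : ℝ) + 1) ^ γ * (((j : ℕ) : ℝ) + 1) ^ γ) =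
      β * (N : ℝ) ^ (2 * γ - 1) * (((i : ℕ) : ℝ) + 1) ^ (-γ) * (((j : ℕ) : ℝ) + 1) ^ (-γ) := by
    rw [Real.rpow_neg (by positivity), Real.rpow_neg (by positivity)]
    field_simp
  rw [chungLuProb, h1, min_eq_left]
  refine (mul_le_of_le_one_right (mul_nonneg hc0 (hx i).1.le) (hx j).2).trans
    ((mul_le_of_le_one_right hc0 (hx i).2).trans (by linarith))

/-- In the Chung-Lu graph the expected number of candidates for a good path is of order
`(log N) ^ (2 - 2γ)`, and a vertex with label of order `K_γ` has degree of order
`(N / K_γ) ^ γ`. -/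
lemma bernProb_chungLuSym_not_exists_isGoodPath_le {β γ : ℝ} (hβ : 0 < β) (hγ : 0 < γ)
    (hβγ : β + 2 * γ < 1) {N : ℕ} {c K r M : ℝ} (hceq : c = β * (N : ℝ) ^ (2 * γ - 1))
    (hKeq : K = bigThreshold γ N) (hreq : r = β / (1 - 2 * γ)) (hMeq : M = 4 ^ γ * β / (1 - γ))
    (hc : c ≤ 1 / 8) (hK : 8 ≤ K) (hKN : 4 * K < N) (hl : 0 < Real.log N) :
    bernProb (chungLuSym β γ N) {S | ¬ ∃ v₁ v₂ v₃ v₄ : Fin N,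
        ((v₁ : ℕ) : ℝ) + 1 ≤ bigThreshold γ N ∧ ((v₄ : ℕ) : ℝ) + 1 ≤ bigThreshold γ N ∧
        IsGoodPath (β / 2 * (N / K) ^ γ) (M * (N / K) ^ γ) S v₁ v₂ v₃ v₄} ≤
      4 / (β ^ 3 / 8 ^ 4 * Real.exp (-(4 * M)) * Real.log N ^ (2 - 2 * γ)) + 4 * (8 * c) +
        2 * (c / (1 - r) + 2 * c / (1 - r) ^ 2 + 2 * c / (1 - r) ^ 2 +
          4 / (β / 2 * (N / K) ^ γ) + 4 / (β / 2 * (N / K) ^ γ)) := by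
  have hγ2 : 2 * γ < 1 := by linarith
  have hγ1 : γ < 1 := by linarith
  have hn : (0 : ℝ) < N := by linarith
  have hK0 : 0 < K := by linarith
  have hc0 : 0 < c := by rw [hceq]; positivity
  let x : Fin N → ℝ := fun i => (((i : ℕ) : ℝ) + 1) ^ (-γ)
  have hx : ∀ i, 0 < x i ∧ x i ≤ 1 :=
    fun i => ⟨by positivity, Real.rpow_le_one_of_one_le_of_nonpos
      (by linarith [(Nat.cast_nonneg (i : ℕ) : (0 : ℝ) ≤ (i : ℕ))]) (by linarith)⟩
  have hpx' : ∀ u v, u ≠ v → chungLuSym β γ N s(u, v) = c * x u * x v := fun u v huv => by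
    rw [chungLuSym_mk huv, chungLuProb_eq hβ hγ (hceq ▸ hc), hceq]
  have hpx0 : ∀ u v, 0 ≤ chungLuSym β γ N s(u, v) ∧
      chungLuSym β γ N s(u, v) ≤ c * x u * x v := by
    intro u v
    have h1 : 0 ≤ c * x u * x v := mul_nonneg (mul_nonneg hc0.le (hx u).1.le) (hx v).1.le
    by_cases huv : u = v
    · have : chungLuSym β γ N s(u, v) = 0 := by simp [chungLuSym, huv]
      rw [this]
      exact ⟨le_rfl, h1⟩
    · rw [hpx' u v huv]
      exact ⟨h1, le_rfl⟩
  have hp0 : ∀ e, 0 ≤ chungLuSym β γ N e := fun e => by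
    induction e using Sym2.ind with
    | _ u v => exact (hpx0 u v).1
  have hsum1 : ∑ i, x i ≤ (N : ℝ) ^ (1 - γ) / (1 - γ) := sum_rpow_neg_le hγ hγ1 N
  have hsum2 : ∑ i, x i ^ 2 ≤ (N : ℝ) ^ (1 - 2 * γ) / (1 - 2 * γ) := by
    refine le_trans (le_of_eq ?_) (sum_rpow_neg_le (by linarith : 0 < 2 * γ) hγ2 N)
    refine Finset.sum_congr rfl fun i _ => ?_
    rw [← Real.rpow_natCast, ← Real.rpow_mul (by positivity)]
    congr 1
    push_cast
    ring
  have hr : c * ∑ v, x v ^ 2 ≤ r := by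
    calc c * ∑ v, x v ^ 2 ≤ c * ((N : ℝ) ^ (1 - 2 * γ) / (1 - 2 * γ)) := by gcongr
      _ = r * ((N : ℝ) ^ (2 * γ - 1) * (N : ℝ) ^ (1 - 2 * γ)) := by
        rw [hceq, hreq]
        ring
      _ = r := by
        rw [← Real.rpow_add hn]
        simp
  have hr1 : r < 1 := by
    rw [hreq, div_lt_one (by linarith)]
    linarith
  -- Up to a constant, this is the expected degree of a vertex of weight one.
  have hcN : (N : ℝ) ^ (2 * γ - 1) * (N : ℝ) ^ (1 - γ) = (N : ℝ) ^ γ := by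
    rw [← Real.rpow_add hn]
    congr 1
    ring
  have hweight : ∀ (T : ℝ) (v : Fin N), 0 < T → T / 4 ≤ ((v : ℕ) : ℝ) + 1 →
      c * x v * ∑ w, x w ≤ M * (N / T) ^ γ := by
    intro T v hT hv
    have h1 : x v ≤ 4 ^ γ * T ^ (-γ) := by
      calc x v ≤ (T / 4) ^ (-γ) :=
            Real.rpow_le_rpow_of_nonpos (by positivity) hv (by linarith)
        _ = 4 ^ γ * T ^ (-γ) := by
            rw [Real.div_rpow hT.le (by norm_num), Real.rpow_neg (by norm_num : (0:ℝ) ≤ 4)]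
            field_simp
    have hxv := hx v
    calc c * x v * ∑ w, x w
        ≤ c * (4 ^ γ * T ^ (-γ)) * ((N : ℝ) ^ (1 - γ) / (1 - γ)) := by
          gcongr
      _ = M * (((N : ℝ) ^ (2 * γ - 1) * (N : ℝ) ^ (1 - γ)) * T ^ (-γ)) := by
          rw [hceq, hMeq]
          ring
      _ = M * (N / T) ^ γ := by
          rw [hcN, Real.div_rpow hn.le hT.le, Real.rpow_neg hT.le]
          rfl
  have hlow : ∀ (T : ℝ) (v : Fin N), ((v : ℕ) : ℝ) + 1 ≤ T → T ^ (-γ) ≤ x v := fun T v hv =>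
    Real.rpow_le_rpow_of_nonpos (by positivity) hv (by linarith)
  have hlabel : ∀ v : Fin N, ((v : ℕ) : ℝ) + 1 ≤ N := fun v => by exact_mod_cast v.2
  -- The ends and the centres get disjoint ranges of labels, so that a path and its reversal are not
  -- both counted; within each range all weights are of the same order.
  let A₁ := labelsIoc N (K / 4) (K / 2)
  let A₂ := labelsIoc N (K / 2) K
  let B₁ := labelsIoc N (N / 4) (N / 2)
  let B₂ := labelsIoc N (N / 2) N
  have hA : ∀ v ∈ A₁ ∪ A₂, K / 4 ≤ ((v : ℕ) : ℝ) + 1 ∧ ((v : ℕ) : ℝ) + 1 ≤ K := by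
    intro v hv
    rw [Finset.mem_union, mem_labelsIoc, mem_labelsIoc] at hv
    rcases hv with hv | hv <;> constructor <;> linarith [hv.1, hv.2]
  have hB : ∀ v ∈ B₁ ∪ B₂, N / 4 < ((v : ℕ) : ℝ) + 1 := by
    intro v hv
    rw [Finset.mem_union, mem_labelsIoc, mem_labelsIoc] at hv
    rcases hv with hv | hv <;> linarith [hv.1, hv.2]
  have hmain := bernProb_not_exists_isGoodPath_le (p := chungLuSym β γ N) (c := c) (r := r)
    (a := K ^ (-γ)) (b := (N : ℝ) ^ (-γ)) (M := M) (d := β / 2 * (N / K) ^ γ)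
    (d' := M * (N / K) ^ γ) (x := x) hc0 hc hx hp0 (fun u v => (hpx0 u v).2) hpx' hr hr1
    (A₁ := A₁) (A₂ := A₂) (B₁ := B₁) (B₂ := B₂)
    (Finset.disjoint_left.2 fun v h h' => by
      have h1 := (mem_labelsIoc.1 h).2
      have h2 := (mem_labelsIoc.1 h').1
      linarith)
    (Finset.disjoint_left.2 fun v h h' => by
      have h1 := (mem_labelsIoc.1 h).2
      have h2 := (mem_labelsIoc.1 h').1
      linarith)
    (Finset.disjoint_left.2 fun v h h' => by
      have h1 := (hA v h).2
      have h2 := hB v h'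
      linarith)
    (by positivity) (fun v hv => hlow _ v (hA v hv).2)
    (by positivity) (fun v _ => hlow _ v (hlabel v))
    (fun v hv => by
      have := hweight N v hn (hB v hv).le
      rwa [div_self hn.ne', Real.one_rpow, mul_one] at this)
    (by positivity) ?_ (fun v hv => hweight K v hK0 (hA v hv).1)
    (m := β ^ 3 / 8 ^ 4 * Real.exp (-(4 * M)) * Real.log N ^ (2 - 2 * γ)) (by positivity) ?_
  · refine le_trans (bernProb_mono ?_ ?_) hmain
    · intro e
      refine ⟨hp0 e, ?_⟩
      induction e using Sym2.ind with
      | _ u v =>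
        exact ((hpx0 u v).2.trans ((mul_le_of_le_one_right (mul_nonneg hc0.le (hx u).1.le)
          (hx v).2).trans (mul_le_of_le_one_right hc0.le (hx u).2))).trans (by linarith)
    · rintro S hS ⟨v₁, h1, v₂, v₃, v₄, h4, h⟩
      exact hS ⟨v₁, v₂, v₃, v₄, hKeq ▸ (hA v₁ (Finset.mem_union_left _ h1)).2,
        hKeq ▸ (hA v₄ (Finset.mem_union_right _ h4)).2, h⟩
  · intro v hv w₁ w₂
    rw [starPairs, Finset.sum_image fun _ _ _ _ h => Sym2.congr_right.1 h]
    have hcard : (N : ℝ) / 2 ≤ (Finset.univ \ {v, w₁, w₂} : Finset (Fin N)).card := by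
      have h1 := Finset.le_card_sdiff ({v, w₁, w₂} : Finset (Fin N)) Finset.univ
      have h2 : ({v, w₁, w₂} : Finset (Fin N)).card ≤ 3 := Finset.card_le_three
      rw [Finset.card_univ, Fintype.card_fin] at h1
      have h3 : N ≤ (Finset.univ \ {v, w₁, w₂} : Finset (Fin N)).card + 3 := by omega
      have h4 : (N : ℝ) ≤ (Finset.univ \ {v, w₁, w₂} : Finset (Fin N)).card + 3 := by
        exact_mod_cast h3
      linarith
    calc β / 2 * (N / K) ^ γ = N / 2 * (c * K ^ (-γ) * (N : ℝ) ^ (-γ)) := by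
          have h1 : (N : ℝ) ^ γ = N * (N : ℝ) ^ (2 * γ - 1) * (N : ℝ) ^ (-γ) := by
            rw [← Real.rpow_one_add' hn.le (by linarith), ← Real.rpow_add hn]
            congr 1
            ring
          rw [hceq, Real.div_rpow hn.le hK0.le, h1, Real.rpow_neg hK0.le]
          ring
      _ ≤ (Finset.univ \ {v, w₁, w₂} : Finset (Fin N)).card *
          (c * K ^ (-γ) * (N : ℝ) ^ (-γ)) := by gcongr
      _ = ∑ w ∈ Finset.univ \ {v, w₁, w₂}, c * K ^ (-γ) * (N : ℝ) ^ (-γ) := by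
          rw [Finset.sum_const, nsmul_eq_mul]
      _ ≤ _ := by
          refine Finset.sum_le_sum fun w hw => ?_
          have hvw : v ≠ w := by
            rintro rfl
            simp at hw
          rw [hpx' v w hvw]
          have := hlow K v (hA v hv).2
          have := hlow N w (hlabel w)
          have := (hx v).1
          gcongr
  · have cA1 := le_card_labelsIoc (N := N) (s := K / 4) (t := K / 2) (by linarith) (by linarith)
      (by linarith)
    have cA2 := le_card_labelsIoc (N := N) (s := K / 2) (t := K) (by linarith) (by linarith)
      (by linarith)
    have cB1 := le_card_labelsIoc (N := N) (s := N / 4) (t := N / 2) (by linarith) (by linarith)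
      (by linarith)
    have cB2 := le_card_labelsIoc (N := N) (s := N / 2) (t := N) (by linarith) (by linarith)
      (by linarith)
    have cA1' : K / 8 ≤ (A₁.card : ℝ) := by linarith
    have cA2' : K / 8 ≤ (A₂.card : ℝ) := by linarith
    have cB1' : N / 8 ≤ (B₁.card : ℝ) := by linarith
    have cB2' : N / 8 ≤ (B₂.card : ℝ) := by linarith
    have e1 : K ^ 2 * (K ^ (-γ)) ^ 2 = K ^ (2 - 2 * γ) := by
      rw [← Real.rpow_natCast, ← Real.rpow_natCast, ← Real.rpow_mul hK0.le,
        ← Real.rpow_add hK0]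
      congr 1
      push_cast
      ring
    have e2 : K ^ (2 - 2 * γ) = (N : ℝ) ^ (1 - 2 * γ) * Real.log N ^ (2 - 2 * γ) := by
      rw [hKeq, bigThreshold, Real.mul_rpow (by positivity) hl.le, ← Real.rpow_mul hn.le,
        div_mul_cancel₀ _ (by linarith)]
    have e3 : (N : ℝ) ^ 2 * ((N : ℝ) ^ (2 * γ - 1)) ^ 3 * ((N : ℝ) ^ (-γ)) ^ 4 *
        (N : ℝ) ^ (1 - 2 * γ) = 1 := by
      rw [← Real.rpow_natCast, ← Real.rpow_natCast, ← Real.rpow_natCast, ← Real.rpow_mul hn.le,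
        ← Real.rpow_mul hn.le, ← Real.rpow_add hn, ← Real.rpow_add hn, ← Real.rpow_add hn]
      convert Real.rpow_zero (N : ℝ) using 2
      push_cast
      ring
    calc β ^ 3 / 8 ^ 4 * Real.exp (-(4 * M)) * Real.log N ^ (2 - 2 * γ)
        = β ^ 3 / 8 ^ 4 * Real.exp (-(4 * M)) * Real.log N ^ (2 - 2 * γ) *
          ((N : ℝ) ^ 2 * ((N : ℝ) ^ (2 * γ - 1)) ^ 3 * ((N : ℝ) ^ (-γ)) ^ 4 *
            (N : ℝ) ^ (1 - 2 * γ)) := by rw [e3, mul_one]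
      _ = β ^ 3 / 8 ^ 4 * Real.exp (-(4 * M)) * ((N : ℝ) ^ 2 * ((N : ℝ) ^ (2 * γ - 1)) ^ 3 *
            ((N : ℝ) ^ (-γ)) ^ 4) * (K ^ 2 * (K ^ (-γ)) ^ 2) := by
          rw [e1, e2]
          ring
      _ = (K / 8 * (N / 8) * (N / 8) * (K / 8)) *
          (c ^ 3 * (K ^ (-γ)) ^ 2 * ((N : ℝ) ^ (-γ)) ^ 4 * Real.exp (-(4 * M))) := by
          rw [hceq]
          ring
      _ ≤ _ := by gcongr

lemma div_bigThreshold {γ : ℝ} (hγ1 : γ < 1) {N : ℕ} (hN : 0 < N) :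
    (N : ℝ) / bigThreshold γ N = (N : ℝ) ^ (1 / (2 - 2 * γ)) / Real.log N := by
  have hn : (0 : ℝ) < N := by exact_mod_cast hN
  rw [bigThreshold, div_mul_eq_div_div]
  congr 1
  nth_rewrite 1 [← Real.rpow_one (N : ℝ)]
  rw [← Real.rpow_sub hn]
  congr 1
  have : 2 - 2 * γ ≠ 0 := by linarith
  rw [eq_div_iff this, sub_mul, one_mul, div_mul_cancel₀ _ this]
  ring

/-- Up to a power of `log N`, a degree of order `(N / K_γ) ^ γ` is `N ^ (γ / (2 - 2γ))`. -/
lemma agreeUpToLog_of_lt {β γ M : ℝ} (hβ : 0 < β) (hγ : 0 < γ) (hγ1 : γ < 1) (hM : 0 ≤ M) {N : ℕ}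
    (hN : 1 ≤ N) (hl1 : 1 ≤ Real.log N) (hlM : 3 / 2 * M + 1 ≤ Real.log N)
    (hlβ : 4 / β ≤ Real.log N ^ (1 - γ)) {t : ℝ}
    (ht : β / 2 * (N / bigThreshold γ N) ^ γ / 2 < t)
    (ht' : t < 3 * (M * (N / bigThreshold γ N) ^ γ) / 2) :
    AgreeUpToLog 1 N (t + 1) ((N : ℝ) ^ (γ / (2 - 2 * γ))) := by
  have hn1 : (1 : ℝ) ≤ N := by exact_mod_cast hN
  have hn : (0 : ℝ) < N := by linarith
  set l := Real.log N with hl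
  have hl0 : 0 < l := by linarith
  set L := (N : ℝ) ^ (γ / (2 - 2 * γ)) with hL
  have hL1 : 1 ≤ L := Real.one_le_rpow hn1 (div_nonneg hγ.le (by linarith))
  have hW : ((N : ℝ) / bigThreshold γ N) ^ γ = L * l ^ (-γ) := by
    rw [div_bigThreshold hγ1 hN, ← hl, Real.div_rpow (by positivity) hl0.le, ← Real.rpow_mul hn.le,
      Real.rpow_neg hl0.le, hL]
    rw [show 1 / (2 - 2 * γ) * γ = γ / (2 - 2 * γ) by ring]
    rfl
  rw [hW] at ht ht'
  have hlγ : l ^ (-γ) ≤ 1 := Real.rpow_le_one_of_one_le_of_nonpos hl1 (by linarith)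
  have hlγ0 : 0 < l ^ (-γ) := by positivity
  rw [AgreeUpToLog, Real.rpow_one]
  constructor
  · have h1 : M * (L * l ^ (-γ)) ≤ M * (L * 1) := by gcongr
    have h2 : L * (3 / 2 * M + 1) ≤ L * l := by gcongr
    nlinarith
  · have h1 : l ^ (1 - γ) = l * l ^ (-γ) := by
      rw [sub_eq_add_neg, Real.rpow_add hl0, Real.rpow_one]
    rw [h1, div_le_iff₀ hβ] at hlβ
    have h2 : β / 4 * L * (l ^ (-γ) * l) ≤ t * l := by
      have := mul_le_mul_of_nonneg_right ht.le hl0.le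
      linarith
    have h3 : L * 4 ≤ L * (l * l ^ (-γ) * β) := by gcongr
    nlinarith

lemma tendsto_div_bigThreshold {γ : ℝ} (hγ : 2 * γ < 1) :
    Tendsto (fun N : ℕ => (N : ℝ) / bigThreshold γ N) atTop atTop := by
  have hs : 0 < 1 / (2 - 2 * γ) := by
    have : 0 < 2 - 2 * γ := by linarith
    positivity
  have h1 : Tendsto (fun y : ℝ => Real.log y / y ^ (1 / (2 - 2 * γ))) atTop (𝓝 0) :=
    (isLittleO_log_rpow_atTop hs).tendsto_div_nhds_zero
  have h2 : Tendsto (fun y : ℝ => Real.log y / y ^ (1 / (2 - 2 * γ))) atTop (𝓝[>] 0) := by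
    refine tendsto_nhdsWithin_iff.2 ⟨h1, ?_⟩
    filter_upwards [eventually_gt_atTop 1] with y hy
    exact div_pos (Real.log_pos hy) (Real.rpow_pos_of_pos (by linarith) _)
  refine (h2.inv_tendsto_nhdsGT_zero.comp tendsto_natCast_atTop_atTop).congr' ?_
  filter_upwards [eventually_gt_atTop 0] with N hN
  simp only [Function.comp, Pi.inv_apply, inv_div]
  exact (div_bigThreshold (by linarith) hN).symm

lemma tendsto_bigThreshold {γ : ℝ} (hγ : 2 * γ < 1) :
    Tendsto (fun N : ℕ => bigThreshold γ N) atTop atTop := by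
  have ha : 0 < (1 - 2 * γ) / (2 - 2 * γ) := div_pos (by linarith) (by linarith)
  exact ((tendsto_rpow_atTop ha).comp tendsto_natCast_atTop_atTop).atTop_mul_atTop₀
    (Real.tendsto_log_atTop.comp tendsto_natCast_atTop_atTop)

end ChungLu

end

theorem mainTheorem10 (β γ : ℝ) (hβ : 0 < β) (hγ : 0 < γ) (hβγ : β + 2 * γ < 1)
    {Ω : ℕ → Type*} [∀ N, MeasurableSpace (Ω N)] (μ : ∀ N, Measure (Ω N))
    [∀ N, IsProbabilityMeasure (μ N)] (G : ∀ N, Ω N → SimpleGraph (Fin N))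
    (hG : InClassG β γ μ G) :
    ∃ C : ℝ, 0 < C ∧
      Tendsto
        (fun N => μ N {ω | ∃ v₁ v₂ v₃ v₄ : Fin N, IsLongDoubleStar γ C (G N ω) v₁ v₂ v₃ v₄})
        atTop (𝓝 1) := by
  obtain ⟨q, -, -, hqG, hlim⟩ := hG
  refine ⟨1, one_pos, ?_⟩
  have hγ2 : 2 * γ < 1 := by linarith
  have hγ1 : γ < 1 := by linarith
  set r := β / (1 - 2 * γ) with hr
  set M := 4 ^ γ * β / (1 - γ) with hM
  have hM0 : 0 ≤ M := div_nonneg (by positivity) (by linarith)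
  let c : ℕ → ℝ := fun N => β * (N : ℝ) ^ (2 * γ - 1)
  let s : ℕ → ℝ := fun N => ∑ i : Fin N, ∑ j : Fin N,
    if i ≠ j then (chungLuProb β γ N i j - q N i j) ^ 2 / chungLuProb β γ N i j else 0
  let err : ℕ → ℝ := fun N =>
    4 / (β ^ 3 / 8 ^ 4 * Real.exp (-(4 * M)) * Real.log N ^ (2 - 2 * γ)) + 4 * (8 * c N) +
      2 * (c N / (1 - r) + 2 * c N / (1 - r) ^ 2 + 2 * c N / (1 - r) ^ 2 +
        4 / (β / 2 * (N / bigThreshold γ N) ^ γ) + 4 / (β / 2 * (N / bigThreshold γ N) ^ γ))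
  have hlog : Tendsto (fun N : ℕ => Real.log N) atTop atTop :=
    Real.tendsto_log_atTop.comp tendsto_natCast_atTop_atTop
  have hclim : Tendsto c atTop (𝓝 0) := by
    have h := (tendsto_rpow_neg_atTop (by linarith : 0 < 1 - 2 * γ)).comp
      (tendsto_natCast_atTop_atTop (R := ℝ))
    have h2 := h.const_mul β
    rw [mul_zero] at h2
    refine h2.congr fun N => ?_
    simp only [Function.comp, c]
    congr 2
    ring
  have herr : Tendsto err atTop (𝓝 0) := by
    have h1 : Tendsto (fun N : ℕ =>
        4 / (β ^ 3 / 8 ^ 4 * Real.exp (-(4 * M)) * Real.log N ^ (2 - 2 * γ))) atTop (𝓝 0) :=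
      Tendsto.const_div_atTop (((tendsto_rpow_atTop (by linarith)).comp hlog).const_mul_atTop
        (by positivity)) _
    have h2 : Tendsto (fun N : ℕ => 4 / (β / 2 * ((N : ℝ) / bigThreshold γ N) ^ γ))
        atTop (𝓝 0) :=
      Tendsto.const_div_atTop (((tendsto_rpow_atTop hγ).comp
        (tendsto_div_bigThreshold hγ2)).const_mul_atTop (by positivity)) _
    have h3 := (h1.add ((hclim.const_mul 8).const_mul 4)).add
      ((((((hclim.div_const (1 - r)).add ((hclim.const_mul 2).div_const ((1 - r) ^ 2))).add
        ((hclim.const_mul 2).div_const ((1 - r) ^ 2))).add h2).add h2).const_mul 2)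
    simpa using h3
  have hdist : Tendsto (fun N => Real.sqrt (Real.exp (2 * s N) - 1)) atTop (𝓝 0) := by
    have h1 : Tendsto (fun N => Real.exp (2 * s N) - 1) atTop (𝓝 (Real.exp (2 * 0) - 1)) :=
      ((Real.continuous_exp.tendsto _).comp (hlim.const_mul 2)).sub_const 1
    simpa using h1.sqrt
  have hreal : Tendsto (fun N => (μ N).real
      {ω | ∃ v₁ v₂ v₃ v₄ : Fin N, IsLongDoubleStar γ 1 (G N ω) v₁ v₂ v₃ v₄}) atTop (𝓝 1) := by
    have hlow : Tendsto (fun N => 1 - err N - Real.sqrt (Real.exp (2 * s N) - 1)) atTop (𝓝 1) := by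
      simpa using (herr.const_sub 1).sub hdist
    refine tendsto_of_tendsto_of_tendsto_of_le_of_le' hlow tendsto_const_nhds ?_
      (Eventually.of_forall fun N => measureReal_le_one)
    filter_upwards [hclim.eventually_le_const (by norm_num : (0 : ℝ) < 1 / 8),
      (tendsto_bigThreshold hγ2).eventually_ge_atTop 8,
      (tendsto_div_bigThreshold hγ2).eventually_gt_atTop 4,
      hlog.eventually_ge_atTop 1, hlog.eventually_ge_atTop (3 / 2 * M + 1),
      ((tendsto_rpow_atTop (by linarith : 0 < 1 - γ)).comp hlog).eventually_ge_atTop (4 / β),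
      eventually_ge_atTop 1] with N hc hK hW hl1 hlM hlβ hN
    have hn : (0 : ℝ) < N := by exact_mod_cast hN
    rw [lt_div_iff₀ (by linarith)] at hW
    let A : Set (Finset (Sym2 (Fin N))) := {S | ¬ ∃ v₁ v₂ v₃ v₄ : Fin N,
      ((v₁ : ℕ) : ℝ) + 1 ≤ bigThreshold γ N ∧ ((v₄ : ℕ) : ℝ) + 1 ≤ bigThreshold γ N ∧
      IsGoodPath (β / 2 * (N / bigThreshold γ N) ^ γ) (M * (N / bigThreshold γ N) ^ γ) S
        v₁ v₂ v₃ v₄}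
    have hA : bernProb (chungLuSym β γ N) A ≤ err N :=
      bernProb_chungLuSym_not_exists_isGoodPath_le hβ hγ hβγ rfl rfl hr hM hc hK hW (by linarith)
    have hsub : {ω | edgesOf (G N ω) ∈ Aᶜ} ⊆
        {ω | ∃ v₁ v₂ v₃ v₄ : Fin N, IsLongDoubleStar γ 1 (G N ω) v₁ v₂ v₃ v₄} := by
      intro ω hω
      obtain ⟨v₁, v₂, v₃, v₄, h1, h4, h⟩ := not_not.1 hω
      exact ⟨v₁, v₂, v₃, v₄, h.isLongDoubleStar h1 h4 fun t ht ht' =>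
        agreeUpToLog_of_lt hβ hγ hγ1 hM0 hN hl1 hlM hlβ ht ht'⟩
    have hp : ∀ i j, 0 < chungLuProb β γ N i j ∧ chungLuProb β γ N i j ≤ 1 / 2 := by
      intro i j
      have hx : ∀ i : Fin N, (((i : ℕ) : ℝ) + 1) ^ (-γ) ≤ 1 := fun i =>
        Real.rpow_le_one_of_one_le_of_nonpos
          (by linarith [(Nat.cast_nonneg (i : ℕ) : (0 : ℝ) ≤ (i : ℕ))]) (by linarith)
      have hc0 : 0 ≤ β * (N : ℝ) ^ (2 * γ - 1) := by positivity
      rw [chungLuProb_eq hβ hγ hc]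
      refine ⟨by positivity, ?_⟩
      refine (mul_le_of_le_one_right (by positivity) (hx j)).trans
        ((mul_le_of_le_one_right hc0 (hx i)).trans (le_trans hc (by norm_num)))
    have hcomp := Real.abs_le_sqrt ((hqG N).sq_measureReal_sub_bernProb_le hp Aᶜ)
    have h1 := (abs_le.1 hcomp).1
    rw [bernProb_compl] at h1
    have h2 := measureReal_mono (μ := μ N) hsub
    change -Real.sqrt (Real.exp (2 * s N) - 1) ≤ _ at h1
    linarith
  have h := ENNReal.tendsto_ofReal hreal
  rw [ENNReal.ofReal_one] at h
  exact h.congr fun N => ofReal_measureReal
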